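/- Let $\mathcal k\in\{\mathbb R,\mathbb C\}$ and let $0<r\le n$ be integers. Let $A,B\in\mathcal k^{n\times n}$ be positive semidefinite Hermitian matrices of rank $r$, and put $\pi(A)=\ker(A)^\perp$, $\pi(B)=\ker(B)^\perp$, points of the Grassmannian $\mathrm{Gr}(r,n)$ of $r$-dimensional subspaces of $\mathcal k^n$. Principal vectors between $U,V\in\mathrm{Gr}(r,n)$ are matrices $a,b\in\mathcal k^{n\times r}$ whose columns are orthonormal bases of $U$ and $V$ such that $a^*b=\operatorname{diag}(\sigma_1,\dots,\sigma_r)$ with $\sigma_1\ge\dots\ge\sigma_r\ge 0$; the principal angles are $\theta_i=\arccos\sigma_i$. Let $d(U,V)=(\sum_i\theta_i^2)^{1/2}$ be the geodesic distance on $\mathrm{Gr}(r,n)$, and for positive definite $r\times r$ matrices $C,D$ let $\delta(C,D)=(\sum_i\log^2\lambda_i)^{1/2}$ be their geodesic distance, where $\lambda_1,\dots,\lambda_r$ are the eigenvalues of $C^{-1/2}DC^{-1/2}$. Let $$\mathcal Z=\{(a^*Aa,\;b^*Bb):(a,b)\text{ principal vectors between }\pi(A)\text{ and }\pi(B)\},$$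 $$\delta_H(\mathcal Z)=\max\Big\{\sup_{x\in p_1(\mathcal Z)}\ \inf_{y:(x,y)\in\mathcal Z}\delta(x,y),\ \sup_{y\in p_2(\mathcal Z)}\ \inf_{x:(x,y)\in\mathcal Z}\delta(x,y)\Big\},$$ where $p_1,p_2$ are the two coordinate projections, and $$\mathrm{GD}_{d,\delta}(A,B)=\big(d(\pi(A),\pi(B))^2+\delta_H(\mathcal Z)^2\big)^{1/2}.$$ For a positive semidefinite $X=uSu^*$ of rank $r$, with $u^*u=I_r$ and $S$ positive definite, every tangent vector at $X$ to the manifold of such matrices is $\xi=\Delta Su^*+uS\Delta^*+uDu^*$ for a unique pair $(\Delta,D)$ with $u^*\Delta=0$ and $D^*=D$. The Riemannian metric $g_1$ is $g_1(\xi,\xi')=\operatorname{Re}\operatorname{tr}(\Delta^*\Delta')+\operatorname{Re}\operatorname{tr}(S^{-1}DS^{-1}D')$; it does not depend on the choice of $(u,S)$. A (Bonnabel–Sepulchre) quasi-geodesic joining $A$ and $B$ is a curve $\mu(t)=u(t)S(t)u(t)^*$, $t\in[0,1]$, where * $u$ is the horizontal lift to the Stiefel manifold of a minimal geodesic of $\mathrm{Gr}(r,n)$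 from $\pi(A)$ to $\pi(B)$: $u$ is smooth, $u^*u=I_r$, $u^*u'=0$, $u''+u\,(u'^*u')=0$, the columns of $u(0)$ and $u(1)$ span $\pi(A)$ and $\pi(B)$, and the length $\int_0^1(\operatorname{tr}u'^*u')^{1/2}dt$ is least among all geodesics with these end points; * $S$ is a geodesic of the cone of positive definite $r\times r$ matrices from $u(0)^*Au(0)$ to $u(1)^*Bu(1)$: $S$ is smooth with $S''=S'S^{-1}S'$. Suppose that all principal angles between $\pi(A)$ and $\pi(B)$ are strictly smaller than $\pi/2$. Then there is a quasi-geodesic joining $A$ and $B$, and every quasi-geodesic $\mu$ joining $A$ and $B$ satisfies $$\mathrm{GD}_{d,\delta}(A,B)=\int_0^1\sqrt{g_1(\mu'(t),\mu'(t))}\,dt .$$ -/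

import Mathlib

open Set Matrix
open scoped ContDiff ComplexOrder

namespace PSDGeom

variable {𝕜 : Type*} [RCLike 𝕜] {n r : ℕ}

/-- `A ∈ Herm⁺_{n,r}`: positive semidefinite `n × n` matrices of rank `r`. -/
def HermPlus (𝕜 : Type*) [RCLike 𝕜] (n r : ℕ) : Set (Matrix (Fin n) (Fin n) 𝕜) :=
  {A | A.PosSemidef ∧ A.rank = r}

/-- The bundle projection `π(A) = ker(A)ᗮ`. -/
noncomputable def proj (A : Matrix (Fin n) (Fin n) 𝕜) :
    Submodule 𝕜 (EuclideanSpace 𝕜 (Fin n)) :=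
  (LinearMap.ker (Matrix.toEuclideanLin A))ᗮ

/-- The columns of `u` form an orthonormal basis of `U`. -/
def IsFrame (U : Submodule 𝕜 (EuclideanSpace 𝕜 (Fin n))) (u : Matrix (Fin n) (Fin r) 𝕜) : Prop :=
  uᴴ * u = 1 ∧ LinearMap.range (Matrix.toEuclideanLin u) = U

/-! ### Principal vectors and principal angles -/

/-- The columns of `a` and `b` are a set of principal vectors between the `r`-dimensional
subspaces `U` and `V`: they are orthonormal bases of `U` and `V`, and `aᴴ b` is diagonal with
real diagonal `σ₁ ≥ ⋯ ≥ σ_r ≥ 0`. -/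
def IsPrincipal (U V : Submodule 𝕜 (EuclideanSpace 𝕜 (Fin n)))
    (a b : Matrix (Fin n) (Fin r) 𝕜) : Prop :=
  IsFrame U a ∧ IsFrame V b ∧ ∃ σ : Fin r → ℝ, Antitone σ ∧ (∀ i, 0 ≤ σ i) ∧
    aᴴ * b = Matrix.diagonal (fun i => (σ i : 𝕜))

/-- The `i`-th principal angle `arccos (aᵢᴴ bᵢ)`; the number does not depend on the chosen
principal vectors (`principalAngle_eq`), so that the infimum is over a one-element set. -/
noncomputable def principalAngle (r : ℕ) (U V : Submodule 𝕜 (EuclideanSpace 𝕜 (Fin n)))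
    (i : Fin r) : ℝ :=
  sInf {θ | ∃ a b : Matrix (Fin n) (Fin r) 𝕜,
    IsPrincipal U V a b ∧ θ = Real.arccos (RCLike.re ((aᴴ * b) i i))}

theorem IsFrame.mul_eq {U : Submodule 𝕜 (EuclideanSpace 𝕜 (Fin n))}
    {u v : Matrix (Fin n) (Fin r) 𝕜} (hu : IsFrame U u) (hv : IsFrame U v) :
    u * (uᴴ * v) = v := by
  have key : ∀ j, ∃ x : Fin r → 𝕜, u *ᵥ x = v *ᵥ (Pi.single j 1) := by
    intro j
    have h : Matrix.toEuclideanLin v (WithLp.toLp 2 (Pi.single j 1)) ∈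
        LinearMap.range (Matrix.toEuclideanLin u) := by
      rw [hu.2, ← hv.2]; exact LinearMap.mem_range_self _ _
    obtain ⟨x, hx⟩ := h
    refine ⟨x.ofLp, ?_⟩
    have := congrArg WithLp.ofLp hx
    simpa using this
  choose x hx using key
  have hv' : v = u * (Matrix.of x)ᵀ := by
    ext i j
    have := congrFun (hx j) i
    simp only [Matrix.mulVec_single_one] at this
    simpa [Matrix.mul_apply, Matrix.mulVec, dotProduct, Matrix.col] using this.symm
  rw [hv', ← Matrix.mul_assoc uᴴ, hu.1, Matrix.one_mul]

theorem sigma_unique {σ τ : Fin r → ℝ} (hσ : Antitone σ) (hτ : Antitone τ)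
    (hσ0 : ∀ i, 0 ≤ σ i) (hτ0 : ∀ i, 0 ≤ τ i) {W T : Matrix (Fin r) (Fin r) 𝕜}
    (hW : Wᴴ * W = 1) (hT : Tᴴ * T = 1)
    (h : Matrix.diagonal (fun i => (τ i : 𝕜)) =
      Wᴴ * Matrix.diagonal (fun i => (σ i : 𝕜)) * T) : τ = σ := by
  have hW' : W * Wᴴ = 1 := mul_eq_one_comm.mp hW
  have h2 : Matrix.diagonal (fun i => ((τ i ^ 2 : ℝ) : 𝕜)) =
      Tᴴ * Matrix.diagonal (fun i => ((σ i ^ 2 : ℝ) : 𝕜)) * T := by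
    have hh : (Matrix.diagonal (fun i => (τ i : 𝕜)))ᴴ * Matrix.diagonal (fun i => (τ i : 𝕜)) =
        Tᴴ * ((Matrix.diagonal (fun i => (σ i : 𝕜)))ᴴ *
          ((W * Wᴴ) * Matrix.diagonal (fun i => (σ i : 𝕜)))) * T := by
      rw [h]; simp only [Matrix.conjTranspose_mul, Matrix.conjTranspose_conjTranspose,
        Matrix.mul_assoc]
    rw [hW', Matrix.one_mul] at hh
    simpa [Matrix.diagonal_conjTranspose, Matrix.diagonal_mul_diagonal, sq, Pi.star_def] using hh
  have h3 := congrArg Matrix.charpoly h2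
  have hinv : (Tᴴ : Matrix (Fin r) (Fin r) 𝕜) = T⁻¹ := (Matrix.inv_eq_left_inv hT).symm
  have hTu : IsUnit T := ⟨⟨T, Tᴴ, mul_eq_one_comm.mp hT, hT⟩, rfl⟩
  obtain ⟨T', rfl⟩ := hTu
  rw [hinv, Matrix.charpoly_units_conj'] at h3
  rw [Matrix.charpoly_diagonal, Matrix.charpoly_diagonal] at h3
  have h4 := congrArg Polynomial.roots h3
  have hroots : ∀ f : Fin r → 𝕜,
      (∏ i, (Polynomial.X - Polynomial.C (f i))).roots = Finset.univ.val.map f := by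
    intro f
    have := Polynomial.roots_multiset_prod_X_sub_C (Finset.univ.val.map f)
    rwa [Multiset.map_map] at this
  rw [hroots, hroots] at h4
  have h5 := congrArg (Multiset.map (fun z : 𝕜 => Real.sqrt (RCLike.re z))) h4
  simp only [Multiset.map_map, Function.comp_def, RCLike.ofReal_re, Real.sqrt_sq (hσ0 _),
    Real.sqrt_sq (hτ0 _)] at h5
  rw [Fin.univ_val_map, Fin.univ_val_map, Multiset.coe_eq_coe] at h5
  exact List.ofFn_injective (List.Perm.eq_of_pairwise' (r := (· ≥ ·))
    hτ.sortedGE_ofFn.pairwise hσ.sortedGE_ofFn.pairwise h5)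

theorem principalAngle_eq {U V : Submodule 𝕜 (EuclideanSpace 𝕜 (Fin n))}
    {a b : Matrix (Fin n) (Fin r) 𝕜} (h : IsPrincipal U V a b) (i : Fin r) :
    principalAngle r U V i = Real.arccos (RCLike.re ((aᴴ * b) i i)) := by
  have hset : {θ | ∃ a b : Matrix (Fin n) (Fin r) 𝕜,
      IsPrincipal U V a b ∧ θ = Real.arccos (RCLike.re ((aᴴ * b) i i))} =
      {Real.arccos (RCLike.re ((aᴴ * b) i i))} := by
    refine Set.eq_singleton_iff_unique_mem.mpr ⟨⟨a, b, h, rfl⟩, ?_⟩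
    rintro _ ⟨a', b', h', rfl⟩
    obtain ⟨ha, hb, σ, hσ, hσ0, hd⟩ := h
    obtain ⟨ha', hb', τ, hτ, hτ0, hd'⟩ := h'
    have e : τ = σ := by
      refine sigma_unique hσ hτ hσ0 hτ0 (W := aᴴ * a') (T := bᴴ * b') (𝕜 := 𝕜) ?_ ?_ ?_
      · rw [Matrix.conjTranspose_mul, Matrix.conjTranspose_conjTranspose, Matrix.mul_assoc,
          ha.mul_eq ha', ha'.1]
      · rw [Matrix.conjTranspose_mul, Matrix.conjTranspose_conjTranspose, Matrix.mul_assoc,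
          hb.mul_eq hb', hb'.1]
      · rw [← hd', ← hd]
        conv_lhs => rw [← ha.mul_eq ha', ← hb.mul_eq hb']
        simp only [Matrix.conjTranspose_mul, Matrix.mul_assoc]
    rw [hd, hd', e]
  rw [principalAngle, hset, csInf_singleton]

/-! ### The geometric distance -/

/-- The generalized Hausdorff function `f_H` of a set `Z ⊆ X × Y` of pairs. -/
noncomputable def hausdorff {X Y : Type*} (f : X → Y → ℝ) (Z : Set (X × Y)) : ℝ :=
  max (sSup ((fun x => sInf ((fun y => f x y) '' {y | (x, y) ∈ Z})) '' (Prod.fst '' Z)))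
    (sSup ((fun y => sInf ((fun x => f x y) '' {x | (x, y) ∈ Z})) '' (Prod.snd '' Z)))

/-- The pairs of matrices that represent `A` restricted to `π(A)` and `B` restricted to `π(B)`
with respect to all possible principal vectors between `π(A)` and `π(B)`. -/
def reprPairs (r : ℕ) (A B : Matrix (Fin n) (Fin n) 𝕜) :
    Set (Matrix (Fin r) (Fin r) 𝕜 × Matrix (Fin r) (Fin r) 𝕜) :=
  {p | ∃ a b : Matrix (Fin n) (Fin r) 𝕜,
    IsPrincipal (proj A) (proj B) a b ∧ p = (aᴴ * A * a, bᴴ * B * b)}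

/-- `GD_{d,δ}(A,B)` for `A, B ∈ Herm⁺_{n,r}`; only the values of `d` on `r`-dimensional subspaces
and of `δ` on positive definite matrices matter. -/
noncomputable def GD
    (d : Submodule 𝕜 (EuclideanSpace 𝕜 (Fin n)) → Submodule 𝕜 (EuclideanSpace 𝕜 (Fin n)) → ℝ)
    (δ : Matrix (Fin r) (Fin r) 𝕜 → Matrix (Fin r) (Fin r) 𝕜 → ℝ)
    (A B : Matrix (Fin n) (Fin n) 𝕜) : ℝ :=
  Real.sqrt (d (proj A) (proj B) ^ 2 + hausdorff δ (reprPairs r A B) ^ 2)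

/-- The geodesic distance `(∑ θᵢ²)^{1/2}` on `Gr(r,n)`. -/
noncomputable def dGr (r : ℕ) (U V : Submodule 𝕜 (EuclideanSpace 𝕜 (Fin n))) : ℝ :=
  Real.sqrt (∑ i : Fin r, principalAngle r U V i ^ 2)

/-- `C^{-1/2}`. -/
noncomputable def invSqrt (C : Matrix (Fin r) (Fin r) 𝕜) : Matrix (Fin r) (Fin r) 𝕜 :=
  cfc (fun x : ℝ => x ^ (-(1 / 2) : ℝ)) C

/-- The geodesic distance `(∑ log² λᵢ)^{1/2}` on `Herm⁺⁺_r`, where the `λᵢ` are the eigenvalues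
of `C^{-1/2} D C^{-1/2}`, with multiplicity. -/
noncomputable def dPD (C D : Matrix (Fin r) (Fin r) 𝕜) : ℝ :=
  Real.sqrt (((invSqrt C * D * invSqrt C).charpoly.roots.map
    (fun z => Real.log (RCLike.re z) ^ 2)).sum)

/-! ### Curves on `[0,1]` -/

/-- The entries of the matrix-valued curve `c` are smooth on `[0,1]`. -/
def SmoothCurve {p q : ℕ} (c : ℝ → Matrix (Fin p) (Fin q) 𝕜) : Prop :=
  ∀ i j, ContDiffOn ℝ ∞ (fun t => c t i j) (Icc 0 1)

/-- The entrywise derivative of a curve on `[0,1]` (one-sided at the end points). -/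
noncomputable def velocity {p q : ℕ} (c : ℝ → Matrix (Fin p) (Fin q) 𝕜) (t : ℝ) :
    Matrix (Fin p) (Fin q) 𝕜 :=
  Matrix.of fun i j => derivWithin (fun s => c s i j) (Icc 0 1) t

/-- `u` is the horizontal lift in the Stiefel manifold `V(n,r)` (with respect to
`V(n,r) → Gr(r,n) = V(n,r) / U(r)`) of a geodesic of `Gr(r,n)` from `U` to `V`: a smooth curve
with `uᴴ u = 1`, `uᴴ u' = 0`, that satisfies the geodesic equation `u'' + u (u'ᴴ u') = 0`. -/
structure IsLiftOfGeodesic (U V : Submodule 𝕜 (EuclideanSpace 𝕜 (Fin n)))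
    (u : ℝ → Matrix (Fin n) (Fin r) 𝕜) : Prop where
  smooth : SmoothCurve u
  orthonormal : ∀ t ∈ Icc (0 : ℝ) 1, (u t)ᴴ * u t = 1
  horizontal : ∀ t ∈ Icc (0 : ℝ) 1, (u t)ᴴ * velocity u t = 0
  geodesic : ∀ t ∈ Icc (0 : ℝ) 1,
    velocity (velocity u) t + u t * ((velocity u t)ᴴ * velocity u t) = 0
  source : IsFrame U (u 0)
  target : IsFrame V (u 1)

/-- The length of a horizontal curve, which is the length in `Gr(r,n)` of its projection. -/
noncomputable def horizontalLength (u : ℝ → Matrix (Fin n) (Fin r) 𝕜) : ℝ :=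
  ∫ t in (0 : ℝ)..1, Real.sqrt (RCLike.re ((velocity u t)ᴴ * velocity u t).trace)

/-- `u` is the horizontal lift of a minimal geodesic, that is, of a geodesic whose length is least
among all geodesics of `Gr(r,n)` from `U` to `V`. -/
def IsLiftOfMinimalGeodesic (U V : Submodule 𝕜 (EuclideanSpace 𝕜 (Fin n)))
    (u : ℝ → Matrix (Fin n) (Fin r) 𝕜) : Prop :=
  IsLiftOfGeodesic U V u ∧ ∀ w : ℝ → Matrix (Fin n) (Fin r) 𝕜,
    IsLiftOfGeodesic U V w → horizontalLength u ≤ horizontalLength w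

/-- `S` is a geodesic of `Herm⁺⁺_r` from `C` to `D`, for the metric `tr (S⁻¹ X S⁻¹ Y)`, whose
geodesic equation is `S'' = S' S⁻¹ S'`. -/
structure IsPDGeodesic (C D : Matrix (Fin r) (Fin r) 𝕜) (S : ℝ → Matrix (Fin r) (Fin r) 𝕜) :
    Prop where
  smooth : SmoothCurve S
  posDef : ∀ t ∈ Icc (0 : ℝ) 1, (S t).PosDef
  geodesic : ∀ t ∈ Icc (0 : ℝ) 1,
    velocity (velocity S) t = velocity S t * (S t)⁻¹ * velocity S t
  source : S 0 = C
  target : S 1 = D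

/-- `μ` is a quasi-geodesic `μ(t) = u(t) S(t) u(t)ᴴ` on `[0,1]` that joins `A` and `B`. -/
def IsQuasiGeodesic (r : ℕ) (A B : Matrix (Fin n) (Fin n) 𝕜)
    (μ : ℝ → Matrix (Fin n) (Fin n) 𝕜) : Prop :=
  ∃ (u : ℝ → Matrix (Fin n) (Fin r) 𝕜) (S : ℝ → Matrix (Fin r) (Fin r) 𝕜),
    IsLiftOfMinimalGeodesic (proj A) (proj B) u ∧
    IsPDGeodesic ((u 0)ᴴ * A * u 0) ((u 1)ᴴ * B * u 1) S ∧
    ∀ t ∈ Icc (0 : ℝ) 1, μ t = u t * S t * (u t)ᴴ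

/-! ### The metrics `g_k` on `Herm⁺_{n,r} = (V(n,r) × Herm⁺⁺_r) / U(r)` -/

/-- `(Δ, D)` is a horizontal tangent vector at `(u, S) ∈ V(n,r) × Herm⁺⁺_r` (`uᴴ Δ = 0`, `D`
Hermitian), and `(u, S) ↦ u S uᴴ` maps `(u, S)` to `X` and, through its differential,
`(Δ, D)` to `ξ`. -/
structure IsHorizontalVector (X ξ : Matrix (Fin n) (Fin n) 𝕜)
    (u : Matrix (Fin n) (Fin r) 𝕜) (S : Matrix (Fin r) (Fin r) 𝕜)
    (Δ : Matrix (Fin n) (Fin r) 𝕜) (D : Matrix (Fin r) (Fin r) 𝕜) : Prop where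
  orthonormal : uᴴ * u = 1
  posDef : S.PosDef
  base : X = u * S * uᴴ
  horizontal : uᴴ * Δ = 0
  hermitian : D.IsHermitian
  tangent : ξ = Δ * S * uᴴ + u * S * Δᴴ + u * D * uᴴ

/-- The metric `tr (Δᴴ Δ') + k tr (S⁻¹ D S⁻¹ D')` on horizontal vectors at `(u, S)`. -/
noncomputable def liftedMetric (k : ℝ) (S : Matrix (Fin r) (Fin r) 𝕜)
    (Δ : Matrix (Fin n) (Fin r) 𝕜) (D : Matrix (Fin r) (Fin r) 𝕜)
    (Δ' : Matrix (Fin n) (Fin r) 𝕜) (D' : Matrix (Fin r) (Fin r) 𝕜) : ℝ :=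
  RCLike.re (Δᴴ * Δ').trace + k * RCLike.re (S⁻¹ * D * S⁻¹ * D').trace

/-- The metric `g_k` at `X ∈ Herm⁺_{n,r}` on tangent vectors `ξ`, `η`: the value of the metric on
their horizontal lifts at a point `(u, S)` over `X`. The value does not depend on that point
(`gMetric_eq`), so that the infimum is over a one-element set. -/
noncomputable def gMetric (r : ℕ) (k : ℝ) (X ξ η : Matrix (Fin n) (Fin n) 𝕜) : ℝ :=
  sInf {c | ∃ (u : Matrix (Fin n) (Fin r) 𝕜) (S : Matrix (Fin r) (Fin r) 𝕜)
    (Δ : Matrix (Fin n) (Fin r) 𝕜) (D : Matrix (Fin r) (Fin r) 𝕜)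
    (Δ' : Matrix (Fin n) (Fin r) 𝕜) (D' : Matrix (Fin r) (Fin r) 𝕜),
    IsHorizontalVector X ξ u S Δ D ∧ IsHorizontalVector X η u S Δ' D' ∧
    c = liftedMetric k S Δ D Δ' D'}

theorem IsHorizontalVector.mul_eq {X ξ : Matrix (Fin n) (Fin n) 𝕜}
    {u Δ : Matrix (Fin n) (Fin r) 𝕜} {S D : Matrix (Fin r) (Fin r) 𝕜}
    (h : IsHorizontalVector X ξ u S Δ D) : ξ * u = Δ * S + u * D := by
  have h0 : Δᴴ * u = 0 := by
    rw [← Matrix.conjTranspose_conjTranspose u, ← Matrix.conjTranspose_mul, h.horizontal,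
      Matrix.conjTranspose_zero]
  rw [h.tangent]
  simp only [Matrix.add_mul, Matrix.mul_assoc, h.orthonormal, h0, Matrix.mul_one, Matrix.mul_zero,
    add_zero]

theorem IsHorizontalVector.change {X ξ : Matrix (Fin n) (Fin n) 𝕜}
    {u v Δ Γ : Matrix (Fin n) (Fin r) 𝕜} {S T D E : Matrix (Fin r) (Fin r) 𝕜}
    (h : IsHorizontalVector X ξ u S Δ D) (g : IsHorizontalVector X ξ v T Γ E) :
    (uᴴ * v)ᴴ * (uᴴ * v) = 1 ∧ T = (uᴴ * v)ᴴ * S * (uᴴ * v) ∧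
      E = (uᴴ * v)ᴴ * D * (uᴴ * v) ∧ Γ = Δ * (uᴴ * v) := by
  have hT : IsUnit T.det := (Matrix.isUnit_iff_isUnit_det _).mp g.posDef.isUnit
  have hS : S = uᴴ * X * u := by
    rw [h.base]
    simp only [Matrix.mul_assoc, h.orthonormal, Matrix.mul_one]
    rw [← Matrix.mul_assoc, h.orthonormal, Matrix.one_mul]
  have hT' : T = vᴴ * X * v := by
    rw [g.base]
    simp only [Matrix.mul_assoc, g.orthonormal, Matrix.mul_one]
    rw [← Matrix.mul_assoc, g.orthonormal, Matrix.one_mul]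
  have huX : u * uᴴ * X = X := by
    rw [h.base]
    simp only [← Matrix.mul_assoc]
    rw [Matrix.mul_assoc u uᴴ u, h.orthonormal, Matrix.mul_one]
  have hXv : X * v = v * T := by
    rw [g.base, Matrix.mul_assoc, g.orthonormal, Matrix.mul_one]
  have huv : u * (uᴴ * v) = v := by
    have e : u * uᴴ * (v * T) = v * T := by rw [← hXv, ← Matrix.mul_assoc, huX]
    have e2 := congrArg (· * T⁻¹) e
    simp only [Matrix.mul_assoc, Matrix.mul_nonsing_inv _ hT, Matrix.mul_one] at e2
    exact e2
  set W := uᴴ * v with hW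
  have hWW : Wᴴ * W = 1 := by
    have : vᴴ * v = 1 := g.orthonormal
    rw [← huv, Matrix.conjTranspose_mul, Matrix.mul_assoc, ← Matrix.mul_assoc uᴴ, h.orthonormal,
      Matrix.one_mul] at this
    exact this
  have hWW' : W * Wᴴ = 1 := mul_eq_one_comm.mp hWW
  have hTW : T = Wᴴ * S * W := by
    rw [hT', hS, ← huv]
    simp only [Matrix.conjTranspose_mul, Matrix.mul_assoc]
  have hD : D = uᴴ * (ξ * u) := by
    rw [h.mul_eq, Matrix.mul_add, ← Matrix.mul_assoc, h.horizontal, Matrix.zero_mul, zero_add,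
      ← Matrix.mul_assoc, h.orthonormal, Matrix.one_mul]
  have hE : E = vᴴ * (ξ * v) := by
    rw [g.mul_eq, Matrix.mul_add, ← Matrix.mul_assoc, g.horizontal, Matrix.zero_mul, zero_add,
      ← Matrix.mul_assoc, g.orthonormal, Matrix.one_mul]
  have hEW : E = Wᴴ * D * W := by
    rw [hE, hD, ← huv]
    simp only [Matrix.conjTranspose_mul, Matrix.mul_assoc]
  refine ⟨hWW, hTW, hEW, ?_⟩
  have e1 : Γ * T + v * E = (Δ * S + u * D) * W := by
    rw [← g.mul_eq, ← h.mul_eq, Matrix.mul_assoc, huv]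
  have e2 : v * E = u * D * W := by
    rw [hEW, ← huv]
    simp only [Matrix.mul_assoc]
    rw [← Matrix.mul_assoc W, hWW', Matrix.one_mul]
  have e3 : Γ * T = Δ * W * T := by
    rw [e2, Matrix.add_mul] at e1
    rw [add_right_cancel e1, hTW]
    simp only [Matrix.mul_assoc]
    rw [← Matrix.mul_assoc W, hWW', Matrix.one_mul]
  have e4 := congrArg (· * T⁻¹) e3
  simpa only [Matrix.mul_assoc, Matrix.mul_nonsing_inv _ hT, Matrix.mul_one] using e4

theorem gMetric_eq {k : ℝ} {X ξ η : Matrix (Fin n) (Fin n) 𝕜}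
    {u Δ Δ' : Matrix (Fin n) (Fin r) 𝕜} {S D D' : Matrix (Fin r) (Fin r) 𝕜}
    (h : IsHorizontalVector X ξ u S Δ D) (h' : IsHorizontalVector X η u S Δ' D') :
    gMetric r k X ξ η = liftedMetric k S Δ D Δ' D' := by
  unfold gMetric
  refine Eq.trans (congrArg sInf ?_) (csInf_singleton (liftedMetric k S Δ D Δ' D'))
  refine Set.eq_singleton_iff_unique_mem.mpr ⟨⟨u, S, Δ, D, Δ', D', h, h', rfl⟩, ?_⟩
  rintro _ ⟨v, T, Γ, E, Γ', E', g, g', rfl⟩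
  obtain ⟨hW, hT, hE, hΓ⟩ := h.change g
  obtain ⟨-, -, hE', hΓ'⟩ := h'.change g'
  set W := uᴴ * v
  have hW' : W * Wᴴ = 1 := mul_eq_one_comm.mp hW
  have hSd : IsUnit S.det := (Matrix.isUnit_iff_isUnit_det _).mp h.posDef.isUnit
  have hTi : T⁻¹ = Wᴴ * S⁻¹ * W := by
    refine Matrix.inv_eq_left_inv ?_
    rw [hT]
    calc Wᴴ * S⁻¹ * W * (Wᴴ * S * W) = Wᴴ * S⁻¹ * (W * Wᴴ) * S * W := by
          simp only [Matrix.mul_assoc]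
      _ = 1 := by
          rw [hW', Matrix.mul_one, Matrix.mul_assoc Wᴴ, Matrix.nonsing_inv_mul _ hSd,
            Matrix.mul_one, hW]
  have c1 : (Γᴴ * Γ').trace = (Δᴴ * Δ').trace := by
    rw [hΓ, hΓ', Matrix.conjTranspose_mul, Matrix.trace_mul_comm, Matrix.mul_assoc,
      ← Matrix.mul_assoc W, hW', Matrix.one_mul, Matrix.trace_mul_comm]
  have c2 : (T⁻¹ * E * T⁻¹ * E').trace = (S⁻¹ * D * S⁻¹ * D').trace := by
    have : T⁻¹ * E * T⁻¹ * E' = Wᴴ * (S⁻¹ * D * S⁻¹ * D' * W) := by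
      rw [hTi, hE, hE']
      calc _ = Wᴴ * S⁻¹ * (W * Wᴴ) * D * (W * Wᴴ) * S⁻¹ * (W * Wᴴ) * D' * W := by
            simp only [Matrix.mul_assoc]
        _ = _ := by rw [hW']; simp only [Matrix.mul_one, Matrix.mul_assoc]
    rw [this, Matrix.trace_mul_comm, Matrix.mul_assoc, hW', Matrix.mul_one]
  rw [liftedMetric, liftedMetric, c1, c2]

/-- The length of a curve `μ : [0,1] → Herm⁺_{n,r}` with respect to `g_k`. -/
noncomputable def gLength (r : ℕ) (k : ℝ) (μ : ℝ → Matrix (Fin n) (Fin n) 𝕜) : ℝ :=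
  ∫ t in (0 : ℝ)..1, Real.sqrt (gMetric r k (μ t) (velocity μ t) (velocity μ t))

end PSDGeom

namespace PSDGeom

variable {𝕜 : Type*} [RCLike 𝕜] {n r : ℕ}

/-! ### Linear algebra -/

/-! The set of pairs over which the Hausdorff function is taken may be infinite, but when all
principal angles are below `π/2` the function `δ` is constant on it. If `(x, y)` and `(x', y')` are
orthonormal frames of the two subspaces, write `x' = xW` and `y' = yT` with `W`, `T` unitary. Then
`W(x'ᴴy')Wᴴ = (xᴴy)(TWᴴ)`. If `xᴴy` and `x'ᴴy'` are both positive definite, uniqueness of the polar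
decomposition forces `T = W`. The two compressions are then conjugated by the same unitary, which
leaves `δ` unchanged (`dPD_eq_of_isFrame`). For principal vectors `aᴴb` is the diagonal matrix of
the cosines, which is positive definite by the assumption on the angles.

The end frames of a minimal geodesic also have a positive definite product. Along a horizontal
geodesic `u'ᴴu'` is a constant matrix, so its equation is linear and gives `u(0)ᴴu(1) = W cos(l)
Wᴴ`, where the `lᵢ²` are the eigenvalues of `u'ᴴu'` and the length is `(∑ lᵢ²)^{1/2}`. The principal
angles are `arccos |cos lᵢ| ≤ lᵢ`, up to order, so the length is at least the distance. An explicit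
geodesic built from principal vectors attains this bound. Minimality therefore makes every `lᵢ` a
principal angle, and all `cos lᵢ` are positive.

Finally, `(u', S')` is the horizontal lift of `μ'`, so its `g₁`-square is `tr u'ᴴu' + tr
(S⁻¹S'S⁻¹S')`. Both terms are constant, equal to `d²` and `δ²`: for the second, `S⁻¹S'` is a first
integral of the geodesic equation. Hence the integrand of the length is the constant `(d² +
δ²)^{1/2}`. -/

theorem _root_.Matrix.IsHermitian.exists_unitary_diagonal {H : Matrix (Fin r) (Fin r) 𝕜}
    (hH : H.IsHermitian) : ∃ W : Matrix (Fin r) (Fin r) 𝕜, Wᴴ * W = 1 ∧ W * Wᴴ = 1 ∧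
      H = W * diagonal (fun i => (hH.eigenvalues i : 𝕜)) * Wᴴ := by
  refine ⟨hH.eigenvectorUnitary, Unitary.coe_star_mul_self hH.eigenvectorUnitary,
    Unitary.coe_mul_star_self hH.eigenvectorUnitary, ?_⟩
  exact hH.spectral_theorem.trans (Unitary.conjStarAlgAut_apply _ _)

theorem mul_mul_mul_cancel_mid {p q s t : ℕ} {X : Matrix (Fin p) (Fin q) 𝕜}
    {Y : Matrix (Fin q) (Fin s) 𝕜} {Z : Matrix (Fin s) (Fin q) 𝕜} {T : Matrix (Fin q) (Fin t) 𝕜}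
    (h : Y * Z = 1) : X * Y * (Z * T) = X * T := by
  rw [Matrix.mul_assoc, ← Matrix.mul_assoc Y, h, Matrix.one_mul]

theorem injective_mulVec_of_mul_eq_one {p q : ℕ} {X : Matrix (Fin p) (Fin q) 𝕜}
    {Y : Matrix (Fin q) (Fin p) 𝕜} (h : X * Y = 1) : Function.Injective Y.mulVec := by
  intro x y hxy
  have := congrArg (X *ᵥ ·) hxy
  simpa [Matrix.mulVec_mulVec, h] using this

theorem invSqrt_isHermitian (C : Matrix (Fin r) (Fin r) 𝕜) : (invSqrt C)ᴴ = invSqrt C :=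
  cfc_predicate (R := ℝ) (p := IsSelfAdjoint) (fun x : ℝ => x ^ (-(1 / 2) : ℝ)) C

theorem invSqrt_mul_mul_invSqrt {C : Matrix (Fin r) (Fin r) 𝕜} (hC : C.PosDef) :
    invSqrt C * C * invSqrt C = 1 := by
  have hs : ∀ x ∈ spectrum ℝ C, 0 < x := by
    intro x hx
    rw [hC.isHermitian.spectrum_real_eq_range_eigenvalues] at hx
    obtain ⟨i, rfl⟩ := hx
    exact hC.eigenvalues_pos i
  -- The power is discontinuous at `0`; positivity of the spectrum is what makes the functional
  -- calculus multiplicative here.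
  have hcont : ContinuousOn (fun x : ℝ => x ^ (-(1 / 2) : ℝ)) (spectrum ℝ C) :=
    fun x hx => (Real.continuousAt_rpow_const x _ (Or.inl (hs x hx).ne')).continuousWithinAt
  have hsa : IsSelfAdjoint C := hC.isHermitian
  have h1 : invSqrt C * C = cfc (fun x : ℝ => x ^ (-(1 / 2) : ℝ) * x) C := by
    rw [cfc_mul _ (fun x => x) C hcont (continuousOn_id' _), cfc_id' ℝ C]
    rfl
  rw [h1, invSqrt, ← cfc_mul (fun x : ℝ => x ^ (-(1 / 2) : ℝ) * x) _ C
    (hcont.mul (continuousOn_id' _)) hcont, ← cfc_one ℝ C]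
  refine cfc_congr fun x hx => ?_
  have hx0 := hs x hx
  simp only [Pi.one_apply]
  have : x ^ (-(1 / 2) : ℝ) * x * x ^ (-(1 / 2) : ℝ) =
      x ^ (-(1 / 2) : ℝ) * x ^ (1 : ℝ) * x ^ (-(1 / 2) : ℝ) := by rw [Real.rpow_one]
  rw [this, ← Real.rpow_add hx0, ← Real.rpow_add hx0]
  norm_num

/-- Simultaneous diagonalisation by congruence. -/
theorem exists_simul_diagonal {C H : Matrix (Fin r) (Fin r) 𝕜} (hC : C.PosDef)
    (hH : H.IsHermitian) : ∃ (P : Matrix (Fin r) (Fin r) 𝕜) (l : Fin r → ℝ), IsUnit P.det ∧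
      C = P * Pᴴ ∧ H = P * diagonal (fun i => (l i : 𝕜)) * Pᴴ := by
  have hJ := invSqrt_mul_mul_invSqrt hC
  have hJh := invSqrt_isHermitian C
  set J := invSqrt C
  have hJJ : J * (C * J) = 1 := by rw [← Matrix.mul_assoc, hJ]
  have hdet : IsUnit J.det := Matrix.isUnit_det_of_right_inverse hJJ
  have hi : (J⁻¹)ᴴ = J⁻¹ := by rw [Matrix.conjTranspose_nonsing_inv, hJh]
  have hK : (J * H * J).IsHermitian := by
    have := Matrix.isHermitian_mul_mul_conjTranspose J hH
    rwa [hJh] at this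
  obtain ⟨W, hW, hW', hd⟩ := hK.exists_unitary_diagonal
  have hWdet : IsUnit W.det := Matrix.isUnit_det_of_right_inverse hW'
  -- Congruence by `J = C^{-1/2}` turns `C` into `1`, and the unitary `W` then diagonalises `JHJ`
  -- while preserving `1`; `P` undoes both.
  refine ⟨J⁻¹ * W, hK.eigenvalues, ?_, ?_, ?_⟩
  · rw [Matrix.det_mul]
    exact ((Matrix.isUnit_nonsing_inv_det_iff).mpr hdet).mul hWdet
  · rw [Matrix.conjTranspose_mul, hi, mul_mul_mul_cancel_mid hW']
    calc C = J⁻¹ * J * C * (J * J⁻¹) := by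
          rw [Matrix.nonsing_inv_mul _ hdet, Matrix.mul_nonsing_inv _ hdet, Matrix.one_mul,
            Matrix.mul_one]
      _ = J⁻¹ * (J * C * J) * J⁻¹ := by simp only [Matrix.mul_assoc]
      _ = _ := by rw [hJ, Matrix.mul_one]
  · rw [Matrix.conjTranspose_mul, hi]
    calc H = J⁻¹ * J * H * (J * J⁻¹) := by
          rw [Matrix.nonsing_inv_mul _ hdet, Matrix.mul_nonsing_inv _ hdet, Matrix.one_mul,
            Matrix.mul_one]
      _ = J⁻¹ * (J * H * J) * J⁻¹ := by simp only [Matrix.mul_assoc]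
      _ = _ := by
        conv_lhs => rw [hd]
        simp only [Matrix.mul_assoc]

theorem charpoly_roots_diagonal (d : Fin r → 𝕜) :
    (diagonal d).charpoly.roots = Finset.univ.val.map d := by
  rw [Matrix.charpoly_diagonal]
  have := Polynomial.roots_multiset_prod_X_sub_C (Finset.univ.val.map d)
  rwa [Multiset.map_map] at this

/-- With `J = (PPᴴ)^{-1/2}` the matrix `JP` is unitary, so the matrix whose eigenvalues define the
distance is unitarily conjugate to `diagonal l`. Together with simultaneous diagonalisation this
replaces every computation with the matrix square root. -/
theorem dPD_mul_diagonal {P : Matrix (Fin r) (Fin r) 𝕜} (hP : IsUnit P.det) (l : Fin r → ℝ) :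
    dPD (P * Pᴴ) (P * diagonal (fun i => (l i : 𝕜)) * Pᴴ) =
      Real.sqrt (∑ i, Real.log (l i) ^ 2) := by
  have hC : (P * Pᴴ).PosDef := by
    have := Matrix.PosDef.conjTranspose_mul_mul_same (Matrix.PosDef.one (n := Fin r) (R := 𝕜))
      (B := Pᴴ) (injective_mulVec_of_mul_eq_one (X := (P⁻¹)ᴴ) (by
        rw [← Matrix.conjTranspose_mul, Matrix.mul_nonsing_inv _ hP, Matrix.conjTranspose_one]))
    simpa using this
  have hJ := invSqrt_mul_mul_invSqrt hC
  have hJh := invSqrt_isHermitian (P * Pᴴ)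
  rw [dPD]
  set J := invSqrt (P * Pᴴ)
  have h1 : (J * P) * (J * P)ᴴ = 1 := by
    rw [Matrix.conjTranspose_mul, hJh, ← hJ]
    simp only [Matrix.mul_assoc]
  have h2 : (J * P)ᴴ * (J * P) = 1 := mul_eq_one_comm.mp h1
  have h3 : J * (P * diagonal (fun i => (l i : 𝕜)) * Pᴴ) * J =
      (J * P) * diagonal (fun i => (l i : 𝕜)) * (J * P)ᴴ := by
    rw [Matrix.conjTranspose_mul, hJh]
    simp only [Matrix.mul_assoc]
  have h4 := Matrix.charpoly_units_conj ⟨J * P, (J * P)ᴴ, h1, h2⟩ (diagonal fun i => (l i : 𝕜))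
  rw [Units.val_mk, Matrix.inv_eq_left_inv h2] at h4
  have h5 : (J * (P * diagonal (fun i => (l i : 𝕜)) * Pᴴ) * J).charpoly =
      (diagonal fun i => (l i : 𝕜)).charpoly := by
    rw [h3]
    exact h4
  rw [h5, charpoly_roots_diagonal, Multiset.map_map, ← Finset.sum_eq_multiset_sum]
  simp

theorem posDef_of_mul_diagonal {P : Matrix (Fin r) (Fin r) 𝕜} (hP : IsUnit P.det) {l : Fin r → ℝ}
    (hl : ∀ i, 0 < l i) : (P * diagonal (fun i => (l i : 𝕜)) * Pᴴ).PosDef := by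
  have hd : (diagonal (fun i => (l i : 𝕜))).PosDef :=
    Matrix.posDef_diagonal_iff.mpr fun i => by simpa using hl i
  have := hd.conjTranspose_mul_mul_same (B := Pᴴ)
    (injective_mulVec_of_mul_eq_one (X := (P⁻¹)ᴴ) (by
        rw [← Matrix.conjTranspose_mul, Matrix.mul_nonsing_inv _ hP, Matrix.conjTranspose_one]))
  simpa using this

theorem pos_of_posDef_mul_diagonal {P : Matrix (Fin r) (Fin r) 𝕜} (hP : IsUnit P.det)
    {l : Fin r → ℝ} (h : (P * diagonal (fun i => (l i : 𝕜)) * Pᴴ).PosDef) (i : Fin r) :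
    0 < l i := by
  have hP' : P⁻¹ * P = 1 := Matrix.nonsing_inv_mul _ hP
  have hP'' : Pᴴ * (P⁻¹)ᴴ = 1 := by
    rw [← Matrix.conjTranspose_mul, hP', Matrix.conjTranspose_one]
  have := h.conjTranspose_mul_mul_same (B := (P⁻¹)ᴴ) (injective_mulVec_of_mul_eq_one hP'')
  rw [Matrix.conjTranspose_conjTranspose] at this
  have e : P⁻¹ * (P * diagonal (fun i => (l i : 𝕜)) * Pᴴ) * (P⁻¹)ᴴ =
      diagonal (fun i => (l i : 𝕜)) := by
    rw [Matrix.mul_assoc, Matrix.mul_assoc _ Pᴴ, hP'', Matrix.mul_one, ← Matrix.mul_assoc, hP',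
      Matrix.one_mul]
  rw [e] at this
  simpa using Matrix.posDef_diagonal_iff.mp this i

/-- If `P` diagonalises the pair `(C, D)` by congruence, `WᴴP` diagonalises the conjugated pair with
the same diagonal. -/
theorem dPD_unitary_conj {C D W : Matrix (Fin r) (Fin r) 𝕜} (hC : C.PosDef) (hD : D.IsHermitian)
    (hW : Wᴴ * W = 1) : dPD (Wᴴ * C * W) (Wᴴ * D * W) = dPD C D := by
  obtain ⟨P, l, hP, rfl, rfl⟩ := exists_simul_diagonal hC hD
  have hWP : IsUnit (Wᴴ * P).det := by
    rw [Matrix.det_mul]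
    exact (Matrix.isUnit_det_of_right_inverse hW).mul hP
  rw [dPD_mul_diagonal hP, ← dPD_mul_diagonal (𝕜 := 𝕜) hWP l]
  simp only [Matrix.conjTranspose_mul, Matrix.conjTranspose_conjTranspose, Matrix.mul_assoc]

-- This is uniqueness of the polar decomposition: `H² = (HR)(HR)ᴴ = G²`, so `H` and `G` are the same
-- positive square root.
open scoped MatrixOrder in
theorem eq_one_of_posDef_mul_unitary {H G R : Matrix (Fin r) (Fin r) 𝕜} (hH : H.PosDef)
    (hG : G.PosDef) (hR : R * Rᴴ = 1) (h : H * R = G) : R = 1 := by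
  have hsq : H * H = G * G := by
    calc H * H = H * R * (H * R)ᴴ := by
          rw [Matrix.conjTranspose_mul, mul_mul_mul_cancel_mid hR, hH.isHermitian.eq]
      _ = G * G := by rw [h, hG.isHermitian.eq]
  have h1 : CFC.sqrt (G * G) = H := CFC.sqrt_unique hsq hH.posSemidef.nonneg
  have h2 : CFC.sqrt (G * G) = G := CFC.sqrt_unique rfl hG.posSemidef.nonneg
  have hHd : IsUnit H.det := (Matrix.isUnit_iff_isUnit_det _).mp hH.isUnit
  rw [← h2, h1] at h
  have := congrArg (H⁻¹ * ·) h
  simpa only [← Matrix.mul_assoc, Matrix.nonsing_inv_mul _ hHd, Matrix.one_mul] using this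

/-! ### Frames and principal vectors -/

theorem finrank_proj {A : Matrix (Fin n) (Fin n) 𝕜} (hA : A ∈ HermPlus 𝕜 n r) :
    Module.finrank 𝕜 (proj A) = r := by
  have h1 := Submodule.finrank_add_finrank_orthogonal
    (LinearMap.ker (Matrix.toEuclideanLin A))
  have h2 := LinearMap.finrank_range_add_finrank_ker (Matrix.toEuclideanLin A)
  have h3 : Module.finrank 𝕜 (LinearMap.range (Matrix.toEuclideanLin A)) = r := by
    rw [← hA.2, Matrix.rank_eq_finrank_range_toLin A (PiLp.basisFun 2 𝕜 (Fin n))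
      (PiLp.basisFun 2 𝕜 (Fin n)), Matrix.toEuclideanLin, Matrix.toLpLin_eq_toLin]
  rw [proj]
  omega

theorem conjTranspose_mul_apply_eq_inner {p q : ℕ} (x : Matrix (Fin n) (Fin p) 𝕜)
    (y : Matrix (Fin n) (Fin q) 𝕜) (i : Fin p) (j : Fin q) :
    (xᴴ * y) i j = inner 𝕜 (WithLp.toLp 2 (fun k => x k i)) (WithLp.toLp 2 (fun k => y k j)) := by
  simp [Matrix.mul_apply, PiLp.inner_apply, mul_comm]

theorem exists_isFrame {U : Submodule 𝕜 (EuclideanSpace 𝕜 (Fin n))}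
    (hU : Module.finrank 𝕜 U = r) : ∃ u : Matrix (Fin n) (Fin r) 𝕜, IsFrame U u := by
  let b := (stdOrthonormalBasis 𝕜 U).reindex (finCongr hU)
  refine ⟨Matrix.of fun i j => (b j : EuclideanSpace 𝕜 (Fin n)).ofLp i, ?_, ?_⟩
  · ext i j
    rw [conjTranspose_mul_apply_eq_inner]
    have := orthonormal_iff_ite.mp b.orthonormal i j
    rw [Matrix.one_apply, ← this]
    rfl
  · have hcol : ∀ x : EuclideanSpace 𝕜 (Fin r),
        Matrix.toEuclideanLin (Matrix.of fun i j => (b j : EuclideanSpace 𝕜 (Fin n)).ofLp i) x =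
          ∑ j, x j • (b j : EuclideanSpace 𝕜 (Fin n)) := by
      intro x
      ext i
      simp [Matrix.mulVec, dotProduct, mul_comm]
    apply le_antisymm
    · rintro _ ⟨x, rfl⟩
      rw [hcol]
      exact Submodule.sum_mem _ fun j _ => Submodule.smul_mem _ _ (b j).2
    · intro y hy
      refine ⟨b.repr ⟨y, hy⟩, ?_⟩
      rw [hcol]
      have := congrArg Subtype.val (b.sum_repr ⟨y, hy⟩)
      simpa using this

theorem IsFrame.mul_unitary {U : Submodule 𝕜 (EuclideanSpace 𝕜 (Fin n))}
    {u : Matrix (Fin n) (Fin r) 𝕜} (hu : IsFrame U u) {W : Matrix (Fin r) (Fin r) 𝕜}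
    (hW : Wᴴ * W = 1) : IsFrame U (u * W) := by
  have hW' : W * Wᴴ = 1 := mul_eq_one_comm.mp hW
  refine ⟨?_, ?_⟩
  · rw [Matrix.conjTranspose_mul, Matrix.mul_assoc, ← Matrix.mul_assoc uᴴ, hu.1, Matrix.one_mul,
      hW]
  · rw [← hu.2]
    apply le_antisymm
    · rintro _ ⟨x, rfl⟩
      exact ⟨WithLp.toLp 2 (W *ᵥ x.ofLp), by ext i; simp [Matrix.mulVec_mulVec]⟩
    · rintro _ ⟨x, rfl⟩
      refine ⟨WithLp.toLp 2 (Wᴴ *ᵥ x.ofLp), ?_⟩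
      ext i
      simp [Matrix.mulVec_mulVec, hW']

theorem IsFrame.unitary_of {U : Submodule 𝕜 (EuclideanSpace 𝕜 (Fin n))}
    {u v : Matrix (Fin n) (Fin r) 𝕜} (hu : IsFrame U u) (hv : IsFrame U v) :
    (uᴴ * v)ᴴ * (uᴴ * v) = 1 := by
  rw [Matrix.conjTranspose_mul, Matrix.conjTranspose_conjTranspose, Matrix.mul_assoc,
    hu.mul_eq hv, hv.1]

/-- The columns of `X` are orthogonal with squared norms `σᵢ²`. Dividing the nonzero ones by `σᵢ`
gives an orthonormal family, and its extension to a basis supplies the columns of `W` where `σᵢ =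
0`. This is the step of the singular value decomposition that yields principal vectors. -/
theorem exists_unitary_mul_diagonal {X : Matrix (Fin r) (Fin r) 𝕜} {σ : Fin r → ℝ}
    (h : Xᴴ * X = diagonal (fun i => ((σ i ^ 2 : ℝ) : 𝕜))) :
    ∃ W : Matrix (Fin r) (Fin r) 𝕜, Wᴴ * W = 1 ∧ X = W * diagonal (fun i => (σ i : 𝕜)) := by
  let x : Fin r → EuclideanSpace 𝕜 (Fin r) := fun i => WithLp.toLp 2 (fun k => X k i)
  have hx : ∀ i j, inner 𝕜 (x i) (x j) = if i = j then ((σ i ^ 2 : ℝ) : 𝕜) else 0 := by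
    intro i j
    rw [← conjTranspose_mul_apply_eq_inner, h, Matrix.diagonal_apply]
  let v : Fin r → EuclideanSpace 𝕜 (Fin r) := fun i => ((σ i : 𝕜)⁻¹) • x i
  have hv : Orthonormal 𝕜 ({i | σ i ≠ 0}.domRestrict v) := by
    rw [orthonormal_iff_ite]
    rintro ⟨i, hi⟩ ⟨j, hj⟩
    have hi' : (σ i : 𝕜) ≠ 0 := by exact_mod_cast hi
    simp only [Set.domRestrict_apply, v, inner_smul_left, inner_smul_right, hx, Subtype.mk.injEq]
    split_ifs with hij
    · subst hij
      simp
      field_simp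
    · simp
  obtain ⟨b, hb⟩ := hv.exists_orthonormalBasis_extension_of_card_eq (by simp)
  refine ⟨Matrix.of fun i j => (b j).ofLp i, ?_, ?_⟩
  · ext i j
    rw [conjTranspose_mul_apply_eq_inner, Matrix.one_apply]
    exact orthonormal_iff_ite.mp b.orthonormal i j
  · ext i j
    rw [Matrix.mul_diagonal]
    by_cases hj : σ j = 0
    · have h0 : x j = 0 := by
        rw [← inner_self_eq_zero (𝕜 := 𝕜), hx]
        simp [hj]
      have := congrArg (fun z : EuclideanSpace 𝕜 (Fin r) => z i) h0
      simpa [hj, x] using this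
    · have hj' : (σ j : 𝕜) ≠ 0 := by exact_mod_cast hj
      rw [Matrix.of_apply, hb j hj]
      simp [v, x]
      field_simp

theorem IsFrame.submatrix_perm {U : Submodule 𝕜 (EuclideanSpace 𝕜 (Fin n))}
    {u : Matrix (Fin n) (Fin r) 𝕜} (hu : IsFrame U u) (e : Equiv.Perm (Fin r)) :
    IsFrame U (u.submatrix id e) := by
  have : u.submatrix id e = u * (1 : Matrix (Fin r) (Fin r) 𝕜).submatrix id e := by
    have := Matrix.submatrix_mul_equiv u (1 : Matrix (Fin r) (Fin r) 𝕜) id (Equiv.refl _) e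
    rw [Matrix.mul_one] at this
    exact this.symm
  rw [this]
  refine hu.mul_unitary ?_
  rw [Matrix.conjTranspose_submatrix, Matrix.conjTranspose_one,
    ← Matrix.submatrix_mul _ _ e id e Function.bijective_id, Matrix.one_mul,
    Matrix.submatrix_one_equiv]

theorem exists_perm_isPrincipal {U V : Submodule 𝕜 (EuclideanSpace 𝕜 (Fin n))}
    {x y : Matrix (Fin n) (Fin r) 𝕜} (hx : IsFrame U x) (hy : IsFrame V y) {d : Fin r → ℝ}
    (hd : ∀ i, 0 ≤ d i) (h : xᴴ * y = diagonal (fun i => (d i : 𝕜))) :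
    ∃ e : Equiv.Perm (Fin r), IsPrincipal U V (x.submatrix id e) (y.submatrix id e) ∧
      (x.submatrix id e)ᴴ * y.submatrix id e = diagonal (fun i => (d (e i) : 𝕜)) := by
  -- Sorting `-d` increasingly puts the cosines in decreasing order.
  let e := Tuple.sort fun i => -d i
  have he : (x.submatrix id e)ᴴ * y.submatrix id e = diagonal (fun i => (d (e i) : 𝕜)) := by
    rw [Matrix.conjTranspose_submatrix, ← Matrix.submatrix_mul _ _ e id e Function.bijective_id, h,
      Matrix.submatrix_diagonal_equiv]
    rfl
  refine ⟨e, ⟨hx.submatrix_perm e, hy.submatrix_perm e, d ∘ e, ?_, fun i => hd _, he⟩, he⟩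
  intro i j hij
  simpa using Tuple.monotone_sort (fun i => -d i) hij

theorem exists_isPrincipal {U V : Submodule 𝕜 (EuclideanSpace 𝕜 (Fin n))}
    (hU : Module.finrank 𝕜 U = r) (hV : Module.finrank 𝕜 V = r) :
    ∃ a b : Matrix (Fin n) (Fin r) 𝕜, IsPrincipal U V a b := by
  obtain ⟨u, hu⟩ := exists_isFrame hU
  obtain ⟨v, hv⟩ := exists_isFrame hV
  have hps : ((uᴴ * v)ᴴ * (uᴴ * v)).PosSemidef := Matrix.posSemidef_conjTranspose_mul_self _
  -- Singular value decomposition of `uᴴv`: `T` holds the right singular vectors, and the left ones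
  -- come from the polar factor of `uᴴvT`.
  obtain ⟨T, hT, hT', hd⟩ := hps.isHermitian.exists_unitary_diagonal
  have h0 : ∀ i, Real.sqrt (hps.isHermitian.eigenvalues i) ^ 2 = hps.isHermitian.eigenvalues i :=
    fun i => Real.sq_sqrt (hps.eigenvalues_nonneg i)
  generalize hps.isHermitian.eigenvalues = l at hd h0
  obtain ⟨W, hW, hX⟩ := exists_unitary_mul_diagonal (X := uᴴ * v * T)
    (σ := fun i => Real.sqrt (l i)) (by
      simp only [h0]
      rw [Matrix.conjTranspose_mul, Matrix.mul_assoc, ← Matrix.mul_assoc _ _ T, hd]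
      simp only [Matrix.mul_assoc, hT, Matrix.mul_one]
      rw [← Matrix.mul_assoc, hT, Matrix.one_mul])
  obtain ⟨e, he, -⟩ := exists_perm_isPrincipal (hu.mul_unitary hW) (hv.mul_unitary hT)
    (d := fun i => Real.sqrt (l i)) (fun i => Real.sqrt_nonneg _) (by
      rw [Matrix.conjTranspose_mul, Matrix.mul_assoc, ← Matrix.mul_assoc uᴴ, hX,
        ← Matrix.mul_assoc, hW, Matrix.one_mul])
  exact ⟨_, _, he⟩

/-- Negative diagonal entries are made positive by changing the signs of columns of `y`, and sorting
then gives principal vectors. The signs have to be allowed because the entries will be cosines of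
angles that are not yet known to be small. -/
theorem exists_perm_principalAngle {U V : Submodule 𝕜 (EuclideanSpace 𝕜 (Fin n))}
    {x y : Matrix (Fin n) (Fin r) 𝕜} (hx : IsFrame U x) (hy : IsFrame V y) {d : Fin r → ℝ}
    (h : xᴴ * y = diagonal (fun i => (d i : 𝕜))) :
    ∃ e : Equiv.Perm (Fin r), ∀ i, principalAngle r U V i = Real.arccos |d (e i)| := by
  let s : Fin r → ℝ := fun i => if d i < 0 then -1 else 1
  have hs : ∀ i, s i * s i = 1 := fun i => by simp only [s]; split_ifs <;> norm_num
  have hds : ∀ i, d i * s i = |d i| := fun i => by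
    simp only [s]
    split_ifs with hi
    · rw [abs_of_neg hi]; ring
    · rw [abs_of_nonneg (not_lt.mp hi)]; ring
  obtain ⟨e, he, he'⟩ := exists_perm_isPrincipal hx
    (hy.mul_unitary (W := diagonal fun i => (s i : 𝕜)) (by
      rw [Matrix.diagonal_conjTranspose, Matrix.diagonal_mul_diagonal, ← Matrix.diagonal_one]
      congr 1
      ext i
      simp only [Pi.star_apply, RCLike.star_def, RCLike.conj_ofReal]
      rw [← RCLike.ofReal_mul, hs, RCLike.ofReal_one]))
    (d := fun i => |d i|) (fun i => abs_nonneg _) (by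
      rw [← Matrix.mul_assoc, h, Matrix.diagonal_mul_diagonal]
      congr 1
      ext i
      rw [← RCLike.ofReal_mul, hds])
  refine ⟨e, fun i => ?_⟩
  rw [principalAngle_eq he, he']
  simp

/-! ### Compressions to frames and their distance -/

/-- A null vector `x` of the compressed form gives a vector `ux` that lies both in `ker A` and in
its orthogonal complement. -/
theorem conjTranspose_mul_mul_posDef {A : Matrix (Fin n) (Fin n) 𝕜} (hA : A.PosSemidef)
    {u : Matrix (Fin n) (Fin r) 𝕜} (hu : IsFrame (proj A) u) : (uᴴ * A * u).PosDef := by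
  have hps : (uᴴ * A * u).PosSemidef := hA.conjTranspose_mul_mul_same u
  refine Matrix.PosDef.of_dotProduct_mulVec_pos hps.isHermitian fun x hx => ?_
  refine lt_of_le_of_ne (hps.dotProduct_mulVec_nonneg x) fun h0 => hx ?_
  have h1 : star (u *ᵥ x) ⬝ᵥ A *ᵥ (u *ᵥ x) = 0 := by
    rw [h0, Matrix.star_mulVec, ← Matrix.dotProduct_mulVec]
    simp only [Matrix.mulVec_mulVec, Matrix.mul_assoc]
  have h2 := (hA.dotProduct_mulVec_zero_iff _).mp h1
  have h3 : WithLp.toLp 2 (u *ᵥ x) ∈ proj A := by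
    rw [← hu.2]
    exact ⟨WithLp.toLp 2 x, by simp⟩
  have h4 : WithLp.toLp 2 (u *ᵥ x) ∈ LinearMap.ker (Matrix.toEuclideanLin A) := by
    rw [LinearMap.mem_ker]
    ext i
    simpa using congrFun h2 i
  have h5 : WithLp.toLp 2 (u *ᵥ x) = 0 :=
    inner_self_eq_zero.mp (Submodule.inner_right_of_mem_orthogonal h4 h3)
  have h6 : u *ᵥ x = 0 := by simpa using congrArg WithLp.ofLp h5
  exact injective_mulVec_of_mul_eq_one hu.1 (by simpa using h6)

/-- Positive definiteness of both cross products couples the two changes of frame: they are the same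
unitary, so the compressions of `A` and `B` are conjugated simultaneously. Without it the changes of
frame could be independent, and `δ` is not invariant under that. -/
theorem dPD_eq_of_isFrame {A B : Matrix (Fin n) (Fin n) 𝕜} (hA : A.PosSemidef)
    (hB : B.PosSemidef) {x y x' y' : Matrix (Fin n) (Fin r) 𝕜} (hx : IsFrame (proj A) x)
    (hy : IsFrame (proj B) y) (hx' : IsFrame (proj A) x') (hy' : IsFrame (proj B) y')
    (h : (xᴴ * y).PosDef) (h' : (x'ᴴ * y').PosDef) :
    dPD (x'ᴴ * A * x') (y'ᴴ * B * y') = dPD (xᴴ * A * x) (yᴴ * B * y) := by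
  have hW := hx.unitary_of hx'
  have hT := hy.unitary_of hy'
  have ex := hx.mul_eq hx'
  have ey := hy.mul_eq hy'
  generalize xᴴ * x' = W at hW ex
  generalize yᴴ * y' = T at hT ey
  have hW' : W * Wᴴ = 1 := mul_eq_one_comm.mp hW
  have e1 : x'ᴴ * y' = Wᴴ * (xᴴ * y) * T := by
    rw [← ex, ← ey]
    simp only [Matrix.conjTranspose_mul, Matrix.mul_assoc]
  -- Positive definite times unitary equals positive definite, so the unitary factor `TWᴴ` must be
  -- `1`.
  have e2 : (xᴴ * y) * (T * Wᴴ) = W * (x'ᴴ * y') * Wᴴ := by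
    rw [e1]
    calc _ = 1 * (xᴴ * y) * T * Wᴴ := by rw [Matrix.one_mul]; simp only [Matrix.mul_assoc]
      _ = _ := by rw [← hW']; simp only [Matrix.mul_assoc]
  have hpd : (W * (x'ᴴ * y') * Wᴴ).PosDef := by
    have := h'.conjTranspose_mul_mul_same (B := Wᴴ) (injective_mulVec_of_mul_eq_one hW')
    rwa [Matrix.conjTranspose_conjTranspose] at this
  have hR : (T * Wᴴ) * (T * Wᴴ)ᴴ = 1 := by
    rw [Matrix.conjTranspose_mul, Matrix.conjTranspose_conjTranspose, mul_mul_mul_cancel_mid hW]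
    exact mul_eq_one_comm.mp hT
  have h1 := eq_one_of_posDef_mul_unitary h hpd hR e2
  have hTW : T = W := by
    have := congrArg (· * W) h1
    simpa [Matrix.mul_assoc, hW] using this
  rw [← ex, ← ey, hTW, ← dPD_unitary_conj (conjTranspose_mul_mul_posDef hA hx)
    (conjTranspose_mul_mul_posDef hB hy).isHermitian hW]
  simp only [Matrix.conjTranspose_mul, Matrix.mul_assoc]

/-- Every infimum and both suprema are over the singleton `{c}`; nonemptiness of `Z` rules out the
default values on the empty set. -/
theorem hausdorff_eq_of_forall {X Y : Type*} {f : X → Y → ℝ} {Z : Set (X × Y)} {c : ℝ}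
    (hZ : Z.Nonempty) (h : ∀ p ∈ Z, f p.1 p.2 = c) : hausdorff f Z = c := by
  have h1 : (fun x => sInf ((fun y => f x y) '' {y | (x, y) ∈ Z})) '' (Prod.fst '' Z) = {c} := by
    refine Set.eq_singleton_iff_nonempty_unique_mem.mpr ⟨(hZ.image _).image _, ?_⟩
    rintro _ ⟨_, ⟨p, hp, rfl⟩, rfl⟩
    have : (fun y => f p.1 y) '' {y | (p.1, y) ∈ Z} = {c} := by
      refine Set.eq_singleton_iff_nonempty_unique_mem.mpr ⟨⟨_, p.2, hp, rfl⟩, ?_⟩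
      rintro _ ⟨y, hy, rfl⟩
      exact h _ hy
    simp only [this, csInf_singleton]
  have h2 : (fun y => sInf ((fun x => f x y) '' {x | (x, y) ∈ Z})) '' (Prod.snd '' Z) = {c} := by
    refine Set.eq_singleton_iff_nonempty_unique_mem.mpr ⟨(hZ.image _).image _, ?_⟩
    rintro _ ⟨_, ⟨p, hp, rfl⟩, rfl⟩
    have : (fun x => f x p.2) '' {x | (x, p.2) ∈ Z} = {c} := by
      refine Set.eq_singleton_iff_nonempty_unique_mem.mpr ⟨⟨_, p.1, hp, rfl⟩, ?_⟩
      rintro _ ⟨y, hy, rfl⟩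
      exact h _ hy
    simp only [this, csInf_singleton]
  rw [hausdorff, h1, h2, csSup_singleton, max_self]

/-! ### Differentiation of matrix-valued curves -/

/-- The entrywise derivative of `c` at `t`, relative to `[0,1]`, is `c'`. -/
def HasVelocity {p q : ℕ} (c : ℝ → Matrix (Fin p) (Fin q) 𝕜) (c' : Matrix (Fin p) (Fin q) 𝕜)
    (t : ℝ) : Prop :=
  ∀ i j, HasDerivWithinAt (fun s => c s i j) (c' i j) (Icc 0 1) t

theorem HasVelocity.velocity_eq {p q : ℕ} {c : ℝ → Matrix (Fin p) (Fin q) 𝕜}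
    {c' : Matrix (Fin p) (Fin q) 𝕜} {t : ℝ} (h : HasVelocity c c' t) (ht : t ∈ Icc (0 : ℝ) 1) :
    velocity c t = c' := by
  ext i j
  exact (h i j).derivWithin (uniqueDiffOn_Icc zero_lt_one t ht)

theorem HasVelocity.congr {p q : ℕ} {c d : ℝ → Matrix (Fin p) (Fin q) 𝕜}
    {c' : Matrix (Fin p) (Fin q) 𝕜} {t : ℝ} (h : HasVelocity c c' t) (ht : t ∈ Icc (0 : ℝ) 1)
    (hcd : ∀ s ∈ Icc (0 : ℝ) 1, d s = c s) : HasVelocity d c' t := fun i j =>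
  (h i j).congr (fun s hs => by rw [hcd s hs]) (by rw [hcd t ht])

theorem HasVelocity.mul {p q s : ℕ} {c : ℝ → Matrix (Fin p) (Fin q) 𝕜}
    {d : ℝ → Matrix (Fin q) (Fin s) 𝕜} {c' : Matrix (Fin p) (Fin q) 𝕜}
    {d' : Matrix (Fin q) (Fin s) 𝕜} {t : ℝ} (hc : HasVelocity c c' t) (hd : HasVelocity d d' t) :
    HasVelocity (fun t => c t * d t) (c' * d t + c t * d') t := by
  intro i j
  simp only [Matrix.mul_apply, Matrix.add_apply, ← Finset.sum_add_distrib]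
  exact HasDerivWithinAt.fun_sum fun k _ => (hc i k).mul (hd k j)

theorem HasVelocity.add {p q : ℕ} {c d : ℝ → Matrix (Fin p) (Fin q) 𝕜}
    {c' d' : Matrix (Fin p) (Fin q) 𝕜} {t : ℝ} (hc : HasVelocity c c' t)
    (hd : HasVelocity d d' t) : HasVelocity (fun t => c t + d t) (c' + d') t :=
  fun i j => (hc i j).add (hd i j)

theorem HasVelocity.conjTranspose {p q : ℕ} {c : ℝ → Matrix (Fin p) (Fin q) 𝕜}
    {c' : Matrix (Fin p) (Fin q) 𝕜} {t : ℝ} (hc : HasVelocity c c' t) :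
    HasVelocity (fun t => (c t)ᴴ) c'ᴴ t := fun i j => (hc j i).star

theorem HasVelocity.const {p q : ℕ} (c : Matrix (Fin p) (Fin q) 𝕜) (t : ℝ) :
    HasVelocity (fun _ => c) 0 t := fun _ _ => hasDerivWithinAt_const _ _ _

theorem HasVelocity.const_mul {p q s : ℕ} (c : Matrix (Fin p) (Fin q) 𝕜)
    {d : ℝ → Matrix (Fin q) (Fin s) 𝕜} {d' : Matrix (Fin q) (Fin s) 𝕜} {t : ℝ}
    (hd : HasVelocity d d' t) : HasVelocity (fun t => c * d t) (c * d') t := by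
  simpa using (HasVelocity.const c t).mul hd

theorem HasVelocity.mul_const {p q s : ℕ} {c : ℝ → Matrix (Fin p) (Fin q) 𝕜}
    {c' : Matrix (Fin p) (Fin q) 𝕜} {t : ℝ} (hc : HasVelocity c c' t)
    (d : Matrix (Fin q) (Fin s) 𝕜) : HasVelocity (fun t => c t * d) (c' * d) t := by
  simpa using hc.mul (HasVelocity.const d t)

theorem HasVelocity.diagonal {f : ℝ → Fin r → ℝ} {f' : Fin r → ℝ} {t : ℝ}
    (h : ∀ i, HasDerivAt (fun s => f s i) (f' i) t) :
    HasVelocity (fun s => Matrix.diagonal (fun i => (f s i : 𝕜)))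
      (Matrix.diagonal (fun i => (f' i : 𝕜))) t := by
  intro i j
  by_cases hij : i = j
  · subst hij
    simpa [RCLike.real_smul_eq_coe_mul] using ((h i).smul_const (1 : 𝕜)).hasDerivWithinAt
  · simpa [Matrix.diagonal_apply_ne _ hij] using hasDerivWithinAt_const t (Icc (0 : ℝ) 1) (0 : 𝕜)

theorem SmoothCurve.hasVelocity {p q : ℕ} {c : ℝ → Matrix (Fin p) (Fin q) 𝕜} (h : SmoothCurve c)
    {t : ℝ} (ht : t ∈ Icc (0 : ℝ) 1) : HasVelocity c (velocity c t) t := fun i j =>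
  ((h i j).differentiableOn (by simp) t ht).hasDerivWithinAt

theorem SmoothCurve.velocity {p q : ℕ} {c : ℝ → Matrix (Fin p) (Fin q) 𝕜} (h : SmoothCurve c) :
    SmoothCurve (velocity c) := fun i j =>
  (h i j).derivWithin (uniqueDiffOn_Icc zero_lt_one) (by simp)

theorem SmoothCurve.mul {p q s : ℕ} {c : ℝ → Matrix (Fin p) (Fin q) 𝕜}
    {d : ℝ → Matrix (Fin q) (Fin s) 𝕜} (hc : SmoothCurve c) (hd : SmoothCurve d) :
    SmoothCurve (fun t => c t * d t) := by
  intro i j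
  simp only [Matrix.mul_apply]
  exact ContDiffOn.sum fun k _ => (hc i k).mul (hd k j)

theorem SmoothCurve.add {p q : ℕ} {c d : ℝ → Matrix (Fin p) (Fin q) 𝕜} (hc : SmoothCurve c)
    (hd : SmoothCurve d) : SmoothCurve (fun t => c t + d t) := fun i j => (hc i j).add (hd i j)

theorem SmoothCurve.const {p q : ℕ} (c : Matrix (Fin p) (Fin q) 𝕜) :
    SmoothCurve (fun _ => c) := fun _ _ => contDiffOn_const

theorem SmoothCurve.diagonal {f : ℝ → Fin r → ℝ} (h : ∀ i, ContDiff ℝ ∞ fun s => f s i) :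
    SmoothCurve (fun s => Matrix.diagonal (fun i => (f s i : 𝕜))) := by
  intro i j
  by_cases hij : i = j
  · subst hij
    have : ContDiffOn ℝ ∞ (fun t => f t i • (1 : 𝕜)) (Icc 0 1) :=
      ((h i).smul contDiff_const).contDiffOn
    simpa [RCLike.real_smul_eq_coe_mul] using this
  · simpa [Matrix.diagonal_apply_ne _ hij] using contDiffOn_const

theorem eq_of_hasVelocity_zero {p q : ℕ} {c : ℝ → Matrix (Fin p) (Fin q) 𝕜}
    (h : ∀ t ∈ Icc (0 : ℝ) 1, HasVelocity c 0 t) {t : ℝ} (ht : t ∈ Icc (0 : ℝ) 1) :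
    c t = c 0 := by
  ext i j
  exact constant_of_derivWithin_zero (f := fun s => c s i j)
    (fun s hs => (h s hs i j).differentiableWithinAt)
    (fun s hs => (h s (Ico_subset_Icc_self hs) i j).derivWithin
      (uniqueDiffOn_Icc zero_lt_one s (Ico_subset_Icc_self hs))) t ht

theorem differentiableWithinAt_det {c : ℝ → Matrix (Fin r) (Fin r) 𝕜} {t : ℝ}
    (h : ∀ i j, DifferentiableWithinAt ℝ (fun s => c s i j) (Icc 0 1) t) :
    DifferentiableWithinAt ℝ (fun s => (c s).det) (Icc 0 1) t := by
  simp only [Matrix.det_apply']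
  exact DifferentiableWithinAt.fun_sum fun σ _ => DifferentiableWithinAt.const_mul
    (DifferentiableWithinAt.fun_finsetProd fun i _ => h _ _) _

/-- Differentiability comes from the adjugate formula; the value of the derivative then follows by
differentiating `c c⁻¹ = 1`. -/
theorem HasVelocity.inv {c : ℝ → Matrix (Fin r) (Fin r) 𝕜} {c' : Matrix (Fin r) (Fin r) 𝕜}
    {t : ℝ} (hc : HasVelocity c c' t) (ht : t ∈ Icc (0 : ℝ) 1)
    (hu : ∀ s ∈ Icc (0 : ℝ) 1, IsUnit (c s).det) :
    HasVelocity (fun s => (c s)⁻¹) (-((c t)⁻¹ * c' * (c t)⁻¹)) t := by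
  have hd : ∀ i j, DifferentiableWithinAt ℝ (fun s => (c s)⁻¹ i j) (Icc 0 1) t := by
    intro i j
    simp only [Matrix.inv_def, Matrix.smul_apply, Ring.inverse_eq_inv', smul_eq_mul,
      Matrix.adjugate_apply]
    refine DifferentiableWithinAt.mul (DifferentiableWithinAt.inv
      (differentiableWithinAt_det fun i j => (hc i j).differentiableWithinAt) (hu t ht).ne_zero) ?_
    refine differentiableWithinAt_det fun k l => ?_
    by_cases hk : k = j
    · subst hk
      simp only [Matrix.updateRow_self]
      exact differentiableWithinAt_const _
    · simp only [Matrix.updateRow_ne hk]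
      exact (hc k l).differentiableWithinAt
  have hv : HasVelocity (fun s => (c s)⁻¹) (PSDGeom.velocity (fun s => (c s)⁻¹) t) t :=
    fun i j => (hd i j).hasDerivWithinAt
  have h1 : c' * (c t)⁻¹ + c t * PSDGeom.velocity (fun s => (c s)⁻¹) t = 0 := by
    rw [← (hc.mul hv).velocity_eq ht]
    exact ((HasVelocity.const 1 t).congr ht fun s hs =>
      Matrix.mul_nonsing_inv _ (hu s hs)).velocity_eq ht
  have h2 : PSDGeom.velocity (fun s => (c s)⁻¹) t = -((c t)⁻¹ * c' * (c t)⁻¹) := by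
    have := congrArg ((c t)⁻¹ * ·) (eq_neg_of_add_eq_zero_right h1)
    simpa only [← Matrix.mul_assoc, Matrix.nonsing_inv_mul _ (hu t ht), Matrix.one_mul,
      Matrix.mul_neg] using this
  rwa [h2] at hv

/-! ### Geodesics of positive definite matrices -/

theorem exists_isPDGeodesic {C D : Matrix (Fin r) (Fin r) 𝕜} (hC : C.PosDef) (hD : D.PosDef) :
    ∃ S : ℝ → Matrix (Fin r) (Fin r) 𝕜, IsPDGeodesic C D S := by
  obtain ⟨P, l, hP, rfl, rfl⟩ := exists_simul_diagonal hC hD.isHermitian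
  have hl := pos_of_posDef_mul_diagonal hP hD
  set m : Fin r → ℝ := fun i => Real.log (l i)
  -- The curve is `P exp(t log l) Pᴴ`. The free coefficient `a` lets one formula give both
  -- derivatives: `a = 1` for the first, `a = m` for the second.
  have hv : ∀ (a : Fin r → ℝ) (t : ℝ), HasVelocity
      (fun t => P * diagonal (fun i => ((a i * Real.exp (m i * t) : ℝ) : 𝕜)) * Pᴴ)
      (P * diagonal (fun i => ((a i * m i * Real.exp (m i * t) : ℝ) : 𝕜)) * Pᴴ) t := by
    intro a t
    refine HasVelocity.mul_const (HasVelocity.const_mul P (HasVelocity.diagonal fun i => ?_)) _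
    have := ((((hasDerivAt_id t).const_mul (m i)).exp).const_mul (a i))
    refine this.congr_deriv ?_
    simp only [id]
    ring
  have e : ∀ t, P * diagonal (fun i => ((Real.exp (m i * t) : ℝ) : 𝕜)) * Pᴴ =
      P * diagonal (fun i => (((1 : Fin r → ℝ) i * Real.exp (m i * t) : ℝ) : 𝕜)) * Pᴴ := by
    simp
  have v1 : ∀ t ∈ Icc (0 : ℝ) 1,
      velocity (fun t => P * diagonal (fun i => ((Real.exp (m i * t) : ℝ) : 𝕜)) * Pᴴ) t =
        P * diagonal (fun i => ((m i * Real.exp (m i * t) : ℝ) : 𝕜)) * Pᴴ := by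
    intro t ht
    refine (((hv 1 t).congr ht fun s _ => e s).velocity_eq ht).trans ?_
    simp
  refine ⟨fun t => P * diagonal (fun i => ((Real.exp (m i * t) : ℝ) : 𝕜)) * Pᴴ, ?_, ?_, ?_, ?_, ?_⟩
  · exact ((SmoothCurve.const P).mul (SmoothCurve.diagonal fun i => by fun_prop)).mul
      (SmoothCurve.const _)
  · exact fun t _ => posDef_of_mul_diagonal hP fun i => Real.exp_pos _
  · intro t ht
    rw [((hv m t).congr ht v1).velocity_eq ht, v1 t ht]
    have hPP : P⁻¹ * P = 1 := Matrix.nonsing_inv_mul _ hP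
    have hPP' : Pᴴ * (P⁻¹)ᴴ = 1 := by
      rw [← Matrix.conjTranspose_mul, hPP, Matrix.conjTranspose_one]
    have hinv : (P * diagonal (fun i => ((Real.exp (m i * t) : ℝ) : 𝕜)) * Pᴴ)⁻¹ =
        (P⁻¹)ᴴ * diagonal (fun i => ((Real.exp (-(m i * t)) : ℝ) : 𝕜)) * P⁻¹ := by
      refine Matrix.inv_eq_right_inv ?_
      rw [Matrix.mul_assoc (P⁻¹)ᴴ, mul_mul_mul_cancel_mid hPP', ← Matrix.mul_assoc,
        Matrix.mul_assoc P, Matrix.diagonal_mul_diagonal]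
      simp only [← RCLike.ofReal_mul, ← Real.exp_add, add_neg_cancel, Real.exp_zero,
        RCLike.ofReal_one, Matrix.diagonal_one, Matrix.mul_one]
      exact Matrix.mul_nonsing_inv _ hP
    have hc : ∀ X : Matrix (Fin r) (Fin r) 𝕜, P⁻¹ * (P * X) = X := fun X => by
      rw [← Matrix.mul_assoc, hPP, Matrix.one_mul]
    have hc' : ∀ X : Matrix (Fin r) (Fin r) 𝕜, Pᴴ * ((P⁻¹)ᴴ * X) = X := fun X => by
      rw [← Matrix.mul_assoc, hPP', Matrix.one_mul]
    rw [hinv]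
    simp only [Matrix.mul_assoc, hc, hc']
    rw [← Matrix.mul_assoc (diagonal _) (diagonal _), Matrix.diagonal_mul_diagonal,
      ← Matrix.mul_assoc (diagonal _) (diagonal _), Matrix.diagonal_mul_diagonal]
    congr 3
    ext i
    rw [← RCLike.ofReal_mul, ← RCLike.ofReal_mul]
    congr 1
    rw [mul_assoc (m i) (Real.exp _), ← Real.exp_add]
    simp [mul_assoc]
  · simp
  · simp only [mul_one, m, Real.exp_log (hl _)]

/-- The first integral `S⁻¹S'` makes the speed constant and reduces the equation to `S' = SK`.
Diagonalising `S(0) = PPᴴ` and `S'(0) = P l Pᴴ` together gives `S(1) = P eˡ Pᴴ`, so the squared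
speed and the squared distance are both `∑ lᵢ²`. -/
theorem IsPDGeodesic.trace_eq {C D : Matrix (Fin r) (Fin r) 𝕜}
    {S : ℝ → Matrix (Fin r) (Fin r) 𝕜} (h : IsPDGeodesic C D S) {t : ℝ}
    (ht : t ∈ Icc (0 : ℝ) 1) :
    RCLike.re ((S t)⁻¹ * velocity S t * (S t)⁻¹ * velocity S t).trace = dPD C D ^ 2 := by
  have h0 : (0 : ℝ) ∈ Icc (0 : ℝ) 1 := ⟨le_rfl, zero_le_one⟩
  have h1 : (1 : ℝ) ∈ Icc (0 : ℝ) 1 := ⟨zero_le_one, le_rfl⟩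
  have hu : ∀ s ∈ Icc (0 : ℝ) 1, IsUnit (S s).det := fun s hs =>
    (Matrix.isUnit_iff_isUnit_det _).mp (h.posDef s hs).isUnit
  have hS := fun s (hs : s ∈ Icc (0 : ℝ) 1) => h.smooth.hasVelocity hs
  have hV := fun s (hs : s ∈ Icc (0 : ℝ) 1) => h.smooth.velocity.hasVelocity hs
  have hK : ∀ s ∈ Icc (0 : ℝ) 1, (S s)⁻¹ * velocity S s = (S 0)⁻¹ * velocity S 0 := by
    intro s hs
    refine eq_of_hasVelocity_zero (c := fun s => (S s)⁻¹ * velocity S s) (fun s hs => ?_) hs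
    have := ((hS s hs).inv hs hu).mul (hV s hs)
    rw [h.geodesic s hs] at this
    convert this using 1
    simp only [Matrix.neg_mul, Matrix.mul_assoc, neg_add_cancel]
  -- A curve of Hermitian matrices has Hermitian derivative.
  have hH0 : (velocity S 0).IsHermitian := by
    have e := ((hS 0 h0).conjTranspose.congr h0 fun s hs =>
      (h.posDef s hs).isHermitian.eq.symm).velocity_eq h0
    exact e.symm
  obtain ⟨P, l, hP, hC, hH⟩ := exists_simul_diagonal (h.posDef 0 h0) hH0
  have hPP : P⁻¹ * P = 1 := Matrix.nonsing_inv_mul _ hP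
  have hPP' : Pᴴ * (P⁻¹)ᴴ = 1 := by
    rw [← Matrix.conjTranspose_mul, hPP, Matrix.conjTranspose_one]
  have hPP'' : P * P⁻¹ = 1 := Matrix.mul_nonsing_inv _ hP
  have hPP''' : (P⁻¹)ᴴ * Pᴴ = 1 := by
    rw [← Matrix.conjTranspose_mul, hPP'', Matrix.conjTranspose_one]
  have hKP : (S 0)⁻¹ * velocity S 0 = (P⁻¹)ᴴ * diagonal (fun i => (l i : 𝕜)) * Pᴴ := by
    have : (S 0)⁻¹ = (P⁻¹)ᴴ * P⁻¹ := Matrix.inv_eq_right_inv (by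
      rw [hC, mul_mul_mul_cancel_mid hPP', hPP''])
    rw [this, hH, Matrix.mul_assoc P, mul_mul_mul_cancel_mid hPP, Matrix.mul_assoc]
  have hVS : ∀ s ∈ Icc (0 : ℝ) 1,
      velocity S s = S s * ((P⁻¹)ᴴ * diagonal (fun i => (l i : 𝕜)) * Pᴴ) := by
    intro s hs
    rw [← hKP, ← hK s hs, ← Matrix.mul_assoc, Matrix.mul_nonsing_inv _ (hu s hs), Matrix.one_mul]
  -- The linear equation is solved with the integrating factor `exp(-lt)`: the product is constant,
  -- hence equal at `0` and `1`.
  have hN : P⁻¹ * S 1 * (P⁻¹)ᴴ * diagonal (fun i => ((Real.exp (-(l i * 1)) : ℝ) : 𝕜)) =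
      P⁻¹ * S 0 * (P⁻¹)ᴴ * diagonal (fun i => ((Real.exp (-(l i * 0)) : ℝ) : 𝕜)) := by
    refine eq_of_hasVelocity_zero (c := fun s => P⁻¹ * S s * (P⁻¹)ᴴ *
      diagonal (fun i => ((Real.exp (-(l i * s)) : ℝ) : 𝕜))) (fun s hs => ?_) h1
    have hd : HasVelocity (fun s => diagonal (fun i => ((Real.exp (-(l i * s)) : ℝ) : 𝕜)))
        (diagonal (fun i => ((-l i * Real.exp (-(l i * s)) : ℝ) : 𝕜))) s := by
      refine HasVelocity.diagonal fun i => ?_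
      have := (((hasDerivAt_id s).const_mul (l i)).neg).exp
      refine this.congr_deriv ?_
      simp only [id, Pi.neg_apply]
      ring
    have := ((HasVelocity.const_mul P⁻¹ (hS s hs)).mul_const (P⁻¹)ᴴ).mul hd
    rw [hVS s hs] at this
    convert this using 1
    have e1 : P⁻¹ * (S s * ((P⁻¹)ᴴ * diagonal (fun i => (l i : 𝕜)) * Pᴴ)) * (P⁻¹)ᴴ =
        P⁻¹ * S s * (P⁻¹)ᴴ * diagonal (fun i => (l i : 𝕜)) := by
      simp only [Matrix.mul_assoc, hPP', Matrix.mul_one]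
    rw [e1, Matrix.mul_assoc _ (diagonal _) (diagonal _), Matrix.diagonal_mul_diagonal,
      ← Matrix.mul_add, Matrix.diagonal_add]
    simp
  have hS1 : S 1 = P * diagonal (fun i => ((Real.exp (l i) : ℝ) : 𝕜)) * Pᴴ := by
    have e0 : P⁻¹ * S 0 * (P⁻¹)ᴴ = 1 := by
      rw [hC, ← Matrix.mul_assoc, hPP, Matrix.one_mul, hPP']
    rw [e0] at hN
    have e1 := congrArg (· * diagonal (fun i => ((Real.exp (l i) : ℝ) : 𝕜))) hN
    simp only [Matrix.mul_assoc, Matrix.diagonal_mul_diagonal, ← RCLike.ofReal_mul,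
      ← Real.exp_add] at e1
    simp only [mul_one, neg_add_cancel, Real.exp_zero, RCLike.ofReal_one, Matrix.diagonal_one,
      mul_zero, neg_zero, zero_add, Matrix.one_mul] at e1
    rw [← e1]
    simp only [Matrix.mul_assoc, hPP''', Matrix.mul_one]
    rw [← Matrix.mul_assoc, hPP'', Matrix.one_mul]
  rw [← h.source, ← h.target, hS1]
  have hdP := dPD_mul_diagonal (𝕜 := 𝕜) hP (fun i => Real.exp (l i))
  rw [← hC] at hdP
  have hKK : (P⁻¹)ᴴ * diagonal (fun i => (l i : 𝕜)) * Pᴴ *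
      ((P⁻¹)ᴴ * diagonal (fun i => (l i : 𝕜)) * Pᴴ) =
      (P⁻¹)ᴴ * (diagonal (fun i => (l i : 𝕜)) * diagonal (fun i => (l i : 𝕜)) * Pᴴ) := by
    rw [Matrix.mul_assoc (P⁻¹)ᴴ (diagonal _) Pᴴ, ← Matrix.mul_assoc, Matrix.mul_assoc _ _ (P⁻¹)ᴴ,
      Matrix.mul_assoc (diagonal _) Pᴴ, hPP', Matrix.mul_one]
    simp only [Matrix.mul_assoc]
  rw [hdP, Real.sq_sqrt (Finset.sum_nonneg fun i _ => sq_nonneg _), Matrix.mul_assoc, hK t ht, hKP,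
    hKK, Matrix.trace_mul_comm, Matrix.mul_assoc, hPP', Matrix.mul_one,
    Matrix.diagonal_mul_diagonal, Matrix.trace_diagonal]
  simp [sq]

/-! ### Geodesics of the Grassmannian -/

/-- Uniqueness for `f'' = -l² f` by first integrals: after subtracting the cosine solution, two
combinations of `h` and `k = h'` are constant and start at `0`. -/
theorem eq_cos_smul_of_hasDerivWithinAt {f g : ℝ → 𝕜} {l : ℝ} {c : 𝕜}
    (hf : ∀ t ∈ Icc (0 : ℝ) 1, HasDerivWithinAt f (g t) (Icc 0 1) t)
    (hg : ∀ t ∈ Icc (0 : ℝ) 1, HasDerivWithinAt g (-(l ^ 2) • f t) (Icc 0 1) t)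
    (hf0 : f 0 = c) (hg0 : g 0 = 0) : f 1 = Real.cos l • c := by
  have const : ∀ {h : ℝ → 𝕜}, (∀ t ∈ Icc (0 : ℝ) 1, HasDerivWithinAt h 0 (Icc 0 1) t) →
      ∀ t ∈ Icc (0 : ℝ) 1, h t = h 0 := fun hh =>
    constant_of_derivWithin_zero (fun s hs => (hh s hs).differentiableWithinAt) fun s hs =>
      (hh s (Ico_subset_Icc_self hs)).derivWithin
        (uniqueDiffOn_Icc zero_lt_one s (Ico_subset_Icc_self hs))
  have hcos : ∀ t, HasDerivAt (fun t => Real.cos (l * t)) (-(l * Real.sin (l * t))) t := by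
    intro t
    have := ((hasDerivAt_id t).const_mul l).cos
    refine this.congr_deriv ?_
    simp [mul_comm]
  have hsin : ∀ t, HasDerivAt (fun t => Real.sin (l * t)) (l * Real.cos (l * t)) t := by
    intro t
    have := ((hasDerivAt_id t).const_mul l).sin
    refine this.congr_deriv ?_
    simp [mul_comm]
  set h : ℝ → 𝕜 := fun t => f t - Real.cos (l * t) • c with hh
  set k : ℝ → 𝕜 := fun t => g t + (l * Real.sin (l * t)) • c with hk
  have dh : ∀ t ∈ Icc (0 : ℝ) 1, HasDerivWithinAt h (k t) (Icc 0 1) t := by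
    intro t ht
    refine ((hf t ht).sub ((hcos t).hasDerivWithinAt.smul_const c)).congr_deriv ?_
    simp only [hk]
    module
  have dk : ∀ t ∈ Icc (0 : ℝ) 1, HasDerivWithinAt k (-(l ^ 2) • h t) (Icc 0 1) t := by
    intro t ht
    refine ((hg t ht).add (((hsin t).const_mul l).hasDerivWithinAt.smul_const c)).congr_deriv ?_
    simp only [hh]
    module
  have h0 : h 0 = 0 := by simp [hh, hf0]
  have k0 : k 0 = 0 := by simp [hk, hg0]
  have ea := const (h := fun t => (l * Real.sin (l * t)) • h t + Real.cos (l * t) • k t)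
    fun t ht => by
      refine ((((hsin t).const_mul l).hasDerivWithinAt.smul (dh t ht)).add
        ((hcos t).hasDerivWithinAt.smul (dk t ht))).congr_deriv ?_
      module
  have eb := const (h := fun t => (l * Real.cos (l * t)) • h t - Real.sin (l * t) • k t)
    fun t ht => by
      refine ((((hcos t).const_mul l).hasDerivWithinAt.smul (dh t ht)).sub
        ((hsin t).hasDerivWithinAt.smul (dk t ht))).congr_deriv ?_
      module
  -- Solving for `k` needs no division by `l`, so `l = 0` is covered; `h` is then constant because
  -- its derivative vanishes.
  have hk0 : ∀ t ∈ Icc (0 : ℝ) 1, k t = 0 := by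
    intro t ht
    have e1 := ea t ht
    have e2 := eb t ht
    simp only [h0, k0, smul_zero, add_zero, sub_zero] at e1 e2
    calc k t = (Real.sin (l * t) ^ 2 + Real.cos (l * t) ^ 2) • k t := by
          rw [Real.sin_sq_add_cos_sq, one_smul]
      _ = Real.cos (l * t) • ((l * Real.sin (l * t)) • h t + Real.cos (l * t) • k t) -
          Real.sin (l * t) • ((l * Real.cos (l * t)) • h t - Real.sin (l * t) • k t) := by
          module
      _ = 0 := by rw [e1, e2]; simp
  have := const (fun t ht => by simpa [hk0 t ht] using dh t ht) 1 ⟨zero_le_one, le_rfl⟩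
  rw [h0] at this
  simpa [hh, sub_eq_zero] using this

/-- Since `Q = u'ᴴu'` is constant, the geodesic equation becomes the linear system `u'' = -uQ`. In
an eigenbasis of `Q` each entry of `u(0)ᴴu` satisfies a scalar oscillator equation, with initial
value from the identity matrix and initial velocity zero by horizontality. -/
theorem IsLiftOfGeodesic.exists_diagonal {U V : Submodule 𝕜 (EuclideanSpace 𝕜 (Fin n))}
    {u : ℝ → Matrix (Fin n) (Fin r) 𝕜} (h : IsLiftOfGeodesic U V u) :
    ∃ (W : Matrix (Fin r) (Fin r) 𝕜) (l : Fin r → ℝ), Wᴴ * W = 1 ∧ (∀ i, 0 ≤ l i) ∧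
      (u 0)ᴴ * u 1 = W * diagonal (fun i => (Real.cos (l i) : 𝕜)) * Wᴴ ∧
      ∀ t ∈ Icc (0 : ℝ) 1, RCLike.re ((velocity u t)ᴴ * velocity u t).trace = ∑ i, l i ^ 2 := by
  have h0 : (0 : ℝ) ∈ Icc (0 : ℝ) 1 := ⟨le_rfl, zero_le_one⟩
  have hv := fun t (ht : t ∈ Icc (0 : ℝ) 1) => h.smooth.hasVelocity ht
  have hvv : ∀ t ∈ Icc (0 : ℝ) 1, HasVelocity (velocity u)
      (-(u t * ((velocity u t)ᴴ * velocity u t))) t := fun t ht => by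
    have := h.smooth.velocity.hasVelocity ht
    rwa [eq_neg_of_add_eq_zero_left (h.geodesic t ht)] at this
  have hhor : ∀ t ∈ Icc (0 : ℝ) 1, (velocity u t)ᴴ * u t = 0 := fun t ht => by
    have := congrArg Matrix.conjTranspose (h.horizontal t ht)
    simpa [Matrix.conjTranspose_mul] using this
  -- The derivative of `u'ᴴu'` contains only terms with a factor `u'ᴴu` or `uᴴu'`, and these vanish.
  have hQ : ∀ t ∈ Icc (0 : ℝ) 1,
      (velocity u t)ᴴ * velocity u t = (velocity u 0)ᴴ * velocity u 0 := by
    intro t ht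
    refine eq_of_hasVelocity_zero (c := fun t => (velocity u t)ᴴ * velocity u t)
      (fun s hs => ?_) ht
    have := (hvv s hs).conjTranspose.mul (hvv s hs)
    convert this using 1
    simp only [Matrix.conjTranspose_neg, Matrix.conjTranspose_mul, Matrix.neg_mul, Matrix.mul_neg,
      Matrix.mul_assoc, h.horizontal s hs, Matrix.mul_zero]
    rw [← Matrix.mul_assoc _ (u s), hhor s hs]
    simp
  have hps : ((velocity u 0)ᴴ * velocity u 0).PosSemidef :=
    Matrix.posSemidef_conjTranspose_mul_self _
  obtain ⟨W, hW, hW', hd⟩ := hps.isHermitian.exists_unitary_diagonal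
  have hl : ∀ i, Real.sqrt (hps.isHermitian.eigenvalues i) ^ 2 = hps.isHermitian.eigenvalues i :=
    fun i => Real.sq_sqrt (hps.eigenvalues_nonneg i)
  generalize hps.isHermitian.eigenvalues = e at hd hl
  refine ⟨W, fun i => Real.sqrt (e i), hW, fun i => Real.sqrt_nonneg _, ?_, fun t ht => ?_⟩
  · have hF : ∀ t ∈ Icc (0 : ℝ) 1, HasVelocity (fun t => Wᴴ * (u 0)ᴴ * u t * W)
        (Wᴴ * (u 0)ᴴ * velocity u t * W) t := fun t ht =>
      (HasVelocity.const_mul _ (hv t ht)).mul_const W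
    have hG : ∀ t ∈ Icc (0 : ℝ) 1, HasVelocity (fun t => Wᴴ * (u 0)ᴴ * velocity u t * W)
        (-(Wᴴ * (u 0)ᴴ * u t * W * diagonal (fun i => (e i : 𝕜)))) t := fun t ht => by
      have := (HasVelocity.const_mul (Wᴴ * (u 0)ᴴ) (hvv t ht)).mul_const W
      rw [hQ t ht, hd] at this
      convert this using 1
      simp only [Matrix.mul_neg, Matrix.neg_mul, Matrix.mul_assoc, hW, Matrix.mul_one]
    have key : Wᴴ * (u 0)ᴴ * u 1 * W = diagonal (fun i => (Real.cos (Real.sqrt (e i)) : 𝕜)) := by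
      ext i j
      have := eq_cos_smul_of_hasDerivWithinAt (f := fun t => (Wᴴ * (u 0)ᴴ * u t * W) i j)
        (g := fun t => (Wᴴ * (u 0)ᴴ * velocity u t * W) i j) (l := Real.sqrt (e j))
        (c := (1 : Matrix (Fin r) (Fin r) 𝕜) i j) (fun t ht => hF t ht i j) (fun t ht => by
          have := hG t ht i j
          rw [Matrix.neg_apply, Matrix.mul_diagonal] at this
          rw [hl, neg_smul, RCLike.real_smul_eq_coe_mul, mul_comm]
          exact this) (by
          rw [Matrix.mul_assoc Wᴴ, h.orthonormal 0 h0, Matrix.mul_one, hW]) (by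
          rw [Matrix.mul_assoc Wᴴ, h.horizontal 0 h0]; simp)
      rw [this, Matrix.one_apply, Matrix.diagonal_apply]
      split_ifs with hij
      · rw [hij, RCLike.real_smul_eq_coe_mul, mul_one]
      · simp
    rw [← key]
    simp only [Matrix.mul_assoc, hW', Matrix.mul_one]
    rw [← Matrix.mul_assoc, hW', Matrix.one_mul]
  · rw [hQ t ht, hd, Matrix.trace_mul_comm, ← Matrix.mul_assoc, hW, Matrix.one_mul,
      Matrix.trace_diagonal]
    simp [hl]

theorem horizontalLength_eq {u : ℝ → Matrix (Fin n) (Fin r) 𝕜} {c : ℝ}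
    (h : ∀ t ∈ Icc (0 : ℝ) 1, RCLike.re ((velocity u t)ᴴ * velocity u t).trace = c) :
    horizontalLength u = Real.sqrt c := by
  rw [horizontalLength, intervalIntegral.integral_congr (g := fun _ => Real.sqrt c)]
  · simp
  · intro t ht
    rw [uIcc_of_le zero_le_one] at ht
    simp only [h t ht]

theorem arccos_abs_cos_le {x : ℝ} (hx : 0 ≤ x) : Real.arccos |Real.cos x| ≤ x := by
  refine (Real.arccos_le_arccos (le_abs_self _)).trans ?_
  rcases le_total x Real.pi with h | h
  · rw [Real.arccos_cos hx h]
  · exact (Real.arccos_le_pi _).trans h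

theorem sum_principalAngle_sq {U V : Submodule 𝕜 (EuclideanSpace 𝕜 (Fin n))}
    {x y : Matrix (Fin n) (Fin r) 𝕜} (hx : IsFrame U x) (hy : IsFrame V y)
    {W : Matrix (Fin r) (Fin r) 𝕜} (hW : Wᴴ * W = 1) {d : Fin r → ℝ}
    (h : xᴴ * y = W * diagonal (fun i => (d i : 𝕜)) * Wᴴ) :
    ∃ e : Equiv.Perm (Fin r), (∀ i, principalAngle r U V i = Real.arccos |d (e i)|) ∧
      ∑ i, principalAngle r U V i ^ 2 = ∑ i, Real.arccos |d i| ^ 2 := by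
  obtain ⟨e, he⟩ := exists_perm_principalAngle (hx.mul_unitary hW) (hy.mul_unitary hW) (d := d) (by
    rw [Matrix.conjTranspose_mul, Matrix.mul_assoc, ← Matrix.mul_assoc xᴴ, h]
    simp only [Matrix.mul_assoc, hW, Matrix.mul_one]
    rw [← Matrix.mul_assoc, hW, Matrix.one_mul])
  refine ⟨e, he, ?_⟩
  simp only [he]
  exact Equiv.sum_comp e fun i => Real.arccos |d i| ^ 2

/-- Termwise `arccos |cos lᵢ| ≤ lᵢ`: an eigenmode may wind further than the principal angle it
realises. -/
theorem IsLiftOfGeodesic.dGr_le {U V : Submodule 𝕜 (EuclideanSpace 𝕜 (Fin n))}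
    {u : ℝ → Matrix (Fin n) (Fin r) 𝕜} (h : IsLiftOfGeodesic U V u) :
    dGr r U V ≤ horizontalLength u := by
  obtain ⟨W, l, hW, hl, h1, h2⟩ := h.exists_diagonal
  obtain ⟨e, -, hs⟩ := sum_principalAngle_sq h.source h.target hW h1
  rw [horizontalLength_eq h2, dGr, hs]
  exact Real.sqrt_le_sqrt (Finset.sum_le_sum fun i _ =>
    pow_le_pow_left₀ (Real.arccos_nonneg _) (arccos_abs_cos_le (hl i)) 2)

/-- Equality of the sums of squares forces equality in every term of the length bound, so each `lᵢ`
is a principal angle and has positive cosine. -/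
theorem IsLiftOfGeodesic.posDef_of_horizontalLength_le
    {U V : Submodule 𝕜 (EuclideanSpace 𝕜 (Fin n))}
    {u : ℝ → Matrix (Fin n) (Fin r) 𝕜} (h : IsLiftOfGeodesic U V u)
    (hle : horizontalLength u ≤ dGr r U V) (hangle : ∀ i, principalAngle r U V i < Real.pi / 2) :
    ((u 0)ᴴ * u 1).PosDef ∧ ∀ t ∈ Icc (0 : ℝ) 1,
      RCLike.re ((velocity u t)ᴴ * velocity u t).trace = dGr r U V ^ 2 := by
  have heq := le_antisymm hle h.dGr_le
  obtain ⟨W, l, hW, hl, h1, h2⟩ := h.exists_diagonal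
  obtain ⟨e, he, hs⟩ := sum_principalAngle_sq h.source h.target hW h1
  rw [horizontalLength_eq h2] at heq
  have hsum : ∑ i, l i ^ 2 = dGr r U V ^ 2 := by
    rw [← heq, Real.sq_sqrt (Finset.sum_nonneg fun i _ => sq_nonneg _)]
  refine ⟨?_, fun t ht => by rw [h2 t ht, hsum]⟩
  have hsum' : ∑ i, Real.arccos |Real.cos (l i)| ^ 2 = ∑ i, l i ^ 2 := by
    rw [hsum, dGr, hs, Real.sq_sqrt (Finset.sum_nonneg fun i _ => sq_nonneg _)]
  have hterm := (Finset.sum_eq_sum_iff_of_le fun i _ =>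
    pow_le_pow_left₀ (Real.arccos_nonneg _) (arccos_abs_cos_le (hl i)) 2).mp hsum'
  have hWd : IsUnit W.det := Matrix.isUnit_det_of_left_inverse hW
  rw [h1]
  refine posDef_of_mul_diagonal hWd fun i => ?_
  have e1 : Real.arccos |Real.cos (l i)| = l i :=
    (pow_left_inj₀ (Real.arccos_nonneg _) (hl i) two_ne_zero).mp (hterm i (Finset.mem_univ i))
  have e2 := hangle (e.symm i)
  rw [he, e.apply_symm_apply, e1] at e2
  exact Real.cos_pos_of_mem_Ioo ⟨by linarith [hl i, Real.pi_pos], e2⟩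

/-! ### The explicit geodesic through principal vectors -/

theorem conjTranspose_diagonal_ofReal (p : Fin r → ℝ) :
    (diagonal (fun i => (p i : 𝕜)))ᴴ = diagonal (fun i => (p i : 𝕜)) := by
  rw [Matrix.diagonal_conjTranspose]
  congr 1
  ext i
  simp

theorem diagonal_ofReal_mul (p q : Fin r → ℝ) :
    diagonal (fun i => (p i : 𝕜)) * diagonal (fun i => (q i : 𝕜)) =
      diagonal (fun i => ((p i * q i : ℝ) : 𝕜)) := by
  rw [Matrix.diagonal_mul_diagonal]
  simp

/-- All products among `u`, `u'` for `u = a cos + c sin` are instances of this one. The weights `ε`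
allow columns of `c` to be zero, as happens for principal angles equal to `0`. -/
theorem conjTranspose_mul_of_orthogonal {a c : Matrix (Fin n) (Fin r) 𝕜} {ε : Fin r → ℝ}
    (ha : aᴴ * a = 1) (hac : aᴴ * c = 0) (hc : cᴴ * c = diagonal (fun i => (ε i : 𝕜)))
    (p q s t : Fin r → ℝ) :
    (a * diagonal (fun i => (p i : 𝕜)) + c * diagonal (fun i => (q i : 𝕜)))ᴴ *
      (a * diagonal (fun i => (s i : 𝕜)) + c * diagonal (fun i => (t i : 𝕜))) =
      diagonal (fun i => ((p i * s i + q i * ε i * t i : ℝ) : 𝕜)) := by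
  have hca : cᴴ * a = 0 := by
    have := congrArg Matrix.conjTranspose hac
    simpa [Matrix.conjTranspose_mul] using this
  have h1 : ∀ X Y Z T : Matrix (Fin r) (Fin r) 𝕜, (Xᴴ * aᴴ + Yᴴ * cᴴ) * (a * Z + c * T) =
      Xᴴ * Z + Yᴴ * diagonal (fun i => (ε i : 𝕜)) * T := by
    intro X Y Z T
    calc _ = Xᴴ * (aᴴ * a) * Z + Xᴴ * (aᴴ * c) * T + (Yᴴ * (cᴴ * a) * Z +
          Yᴴ * (cᴴ * c) * T) := by
          simp only [Matrix.mul_add, Matrix.add_mul, Matrix.mul_assoc]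
          abel
      _ = _ := by rw [ha, hac, hca, hc]; simp
  rw [Matrix.conjTranspose_add, Matrix.conjTranspose_mul, Matrix.conjTranspose_mul, h1,
    conjTranspose_diagonal_ofReal, conjTranspose_diagonal_ofReal, diagonal_ofReal_mul,
    diagonal_ofReal_mul, diagonal_ofReal_mul, Matrix.diagonal_add]
  simp

/-- Each `aᵢ` is rotated towards `bᵢ` through the angle `θᵢ`, in the plane that they span: `u(t) = a
cos(θt) + c sin(θt)`, where `c` is the normalised component of `b` orthogonal to `a`. -/
theorem IsPrincipal.exists_isLiftOfGeodesic {U V : Submodule 𝕜 (EuclideanSpace 𝕜 (Fin n))}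
    {a b : Matrix (Fin n) (Fin r) 𝕜} (h : IsPrincipal U V a b) :
    ∃ u : ℝ → Matrix (Fin n) (Fin r) 𝕜, IsLiftOfGeodesic U V u ∧
      horizontalLength u = dGr r U V := by
  have hangle := principalAngle_eq h
  obtain ⟨ha, hb, σ, -, hσ, hab⟩ := h
  have hangle' : ∀ i, principalAngle r U V i = Real.arccos (σ i) := fun i => by
    rw [hangle, hab]; simp
  have hba : bᴴ * a = diagonal (fun i => (σ i : 𝕜)) := by
    rw [← conjTranspose_diagonal_ofReal, ← hab, Matrix.conjTranspose_mul,
      Matrix.conjTranspose_conjTranspose]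
  set E := b - a * diagonal (fun i => (σ i : 𝕜)) with hE
  have haE : aᴴ * E = 0 := by
    rw [hE, Matrix.mul_sub, ← Matrix.mul_assoc, ha.1, Matrix.one_mul, hab, sub_self]
  have hEE : Eᴴ * E = diagonal (fun i => ((1 - σ i ^ 2 : ℝ) : 𝕜)) := by
    have : Eᴴ * E = bᴴ * E := by
      conv_lhs => rw [hE]
      rw [Matrix.conjTranspose_sub, Matrix.sub_mul, Matrix.conjTranspose_mul, Matrix.mul_assoc,
        haE, Matrix.mul_zero, sub_zero]
    rw [this, hE, Matrix.mul_sub, ← Matrix.mul_assoc, hb.1, hba, diagonal_ofReal_mul,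
      ← Matrix.diagonal_one, Matrix.diagonal_sub]
    congr 1
    ext i
    simp [sq]
  -- The diagonal of the Gram matrix of `E` is nonnegative; this gives `cos (arccos σᵢ) = σᵢ`.
  have hσ1 : ∀ i, σ i ^ 2 ≤ 1 := by
    intro i
    have := (Matrix.posSemidef_conjTranspose_mul_self E).diag_nonneg (i := i)
    rw [hEE, Matrix.diagonal_apply_eq] at this
    have : (0 : ℝ) ≤ 1 - σ i ^ 2 := by exact_mod_cast this
    linarith
  set θ : Fin r → ℝ := fun i => Real.arccos (σ i) with hθ
  have hcosθ : ∀ i, Real.cos (θ i) = σ i := fun i =>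
    Real.cos_arccos (by linarith [hσ i]) (by nlinarith [hσ i, hσ1 i])
  have hsinθ : ∀ i, Real.sin (θ i) ^ 2 = 1 - σ i ^ 2 := fun i => by
    rw [Real.sin_sq, hcosθ]
  have hE0 : ∀ i, Real.sin (θ i) = 0 → ∀ k, E k i = 0 := by
    intro i hi k
    have h1 : (Eᴴ * E) i i = 0 := by
      rw [hEE, Matrix.diagonal_apply_eq, ← hsinθ, hi]; simp
    rw [conjTranspose_mul_apply_eq_inner, inner_self_eq_zero] at h1
    simpa using congrArg (fun z : EuclideanSpace 𝕜 (Fin n) => z k) h1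
  have hθ0 : ∀ i, Real.sin (θ i) = 0 → θ i = 0 := by
    intro i hi
    have h1 : σ i = 1 := by
      have := hsinθ i
      rw [hi] at this
      nlinarith [hσ i]
    simp only [hθ, h1, Real.arccos_one]
  -- When `sin θᵢ = 0` the convention `0⁻¹ = 0` makes this column zero; then `θᵢ = 0` and the `i`-th
  -- column of `u` is constant.
  set c := E * diagonal (fun i => (((Real.sin (θ i))⁻¹ : ℝ) : 𝕜)) with hc
  set ε : Fin r → ℝ := fun i => if Real.sin (θ i) = 0 then 0 else 1 with hε
  have hac : aᴴ * c = 0 := by rw [hc, ← Matrix.mul_assoc, haE, Matrix.zero_mul]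
  have hcc : cᴴ * c = diagonal (fun i => (ε i : 𝕜)) := by
    rw [hc, Matrix.conjTranspose_mul, conjTranspose_diagonal_ofReal, Matrix.mul_assoc,
      ← Matrix.mul_assoc Eᴴ, hEE, diagonal_ofReal_mul, diagonal_ofReal_mul]
    congr 1
    ext i
    congr 1
    rw [← hsinθ]
    simp only [hε]
    split_ifs with hi
    · simp [hi]
    · field_simp
  -- Derivatives of `u` carry factors `θᵢ`, which absorb the zero columns of `c`.
  have hεθ : ∀ i, ε i * θ i = θ i := by
    intro i
    simp only [hε]
    split_ifs with hi
    · rw [hθ0 i hi, mul_zero]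
    · rw [one_mul]
  have gram := conjTranspose_mul_of_orthogonal ha.1 hac hcc
  have hcos : ∀ i t, HasDerivAt (fun t => Real.cos (θ i * t)) (-θ i * Real.sin (θ i * t)) t := by
    intro i t
    refine (((hasDerivAt_id t).const_mul (θ i)).cos).congr_deriv ?_
    simp [mul_comm]
  have hsin : ∀ i t, HasDerivAt (fun t => Real.sin (θ i * t)) (θ i * Real.cos (θ i * t)) t := by
    intro i t
    refine (((hasDerivAt_id t).const_mul (θ i)).sin).congr_deriv ?_
    simp [mul_comm]
  set u : ℝ → Matrix (Fin n) (Fin r) 𝕜 := fun t =>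
    a * diagonal (fun i => ((Real.cos (θ i * t) : ℝ) : 𝕜)) +
      c * diagonal (fun i => ((Real.sin (θ i * t) : ℝ) : 𝕜)) with hu
  have v1 : ∀ t ∈ Icc (0 : ℝ) 1, velocity u t =
      a * diagonal (fun i => ((-θ i * Real.sin (θ i * t) : ℝ) : 𝕜)) +
      c * diagonal (fun i => ((θ i * Real.cos (θ i * t) : ℝ) : 𝕜)) := fun t ht =>
    ((HasVelocity.const_mul a (HasVelocity.diagonal fun i => hcos i t)).add
      (HasVelocity.const_mul c (HasVelocity.diagonal fun i => hsin i t))).velocity_eq ht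
  have v2 : ∀ t ∈ Icc (0 : ℝ) 1, velocity (velocity u) t =
      a * diagonal (fun i => ((-θ i * (θ i * Real.cos (θ i * t)) : ℝ) : 𝕜)) +
      c * diagonal (fun i => ((θ i * (-θ i * Real.sin (θ i * t)) : ℝ) : 𝕜)) := fun t ht =>
    (((HasVelocity.const_mul a (HasVelocity.diagonal fun i => (hsin i t).const_mul (-θ i))).add
      (HasVelocity.const_mul c (HasVelocity.diagonal fun i => (hcos i t).const_mul (θ i)))).congr
        ht v1).velocity_eq ht
  have hQ : ∀ t ∈ Icc (0 : ℝ) 1, (velocity u t)ᴴ * velocity u t =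
      diagonal (fun i => ((θ i ^ 2 : ℝ) : 𝕜)) := by
    intro t ht
    rw [v1 t ht, gram]
    congr 1
    ext i
    congr 1
    linear_combination (θ i * Real.cos (θ i * t) ^ 2) * hεθ i +
      θ i ^ 2 * Real.sin_sq_add_cos_sq (θ i * t)
  refine ⟨u, ⟨?_, ?_, ?_, ?_, ?_, ?_⟩, ?_⟩
  · exact ((SmoothCurve.const a).mul (SmoothCurve.diagonal fun i => by fun_prop)).add
      ((SmoothCurve.const c).mul (SmoothCurve.diagonal fun i => by fun_prop))
  · intro t ht
    rw [hu, gram, ← Matrix.diagonal_one]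
    congr 1
    ext i
    rw [← RCLike.ofReal_one]
    congr 1
    by_cases hi : Real.sin (θ i) = 0
    · simp [hθ0 i hi]
    · have : ε i = 1 := if_neg hi
      rw [this]
      linear_combination Real.sin_sq_add_cos_sq (θ i * t)
  · intro t ht
    rw [v1 t ht, hu, gram, ← Matrix.diagonal_zero]
    congr 1
    ext i
    rw [← RCLike.ofReal_zero]
    congr 1
    linear_combination (Real.sin (θ i * t) * Real.cos (θ i * t)) * hεθ i
  · intro t ht
    rw [hQ t ht, v2 t ht, hu, Matrix.add_mul, Matrix.mul_assoc a, Matrix.mul_assoc c,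
      diagonal_ofReal_mul, diagonal_ofReal_mul, add_add_add_comm, ← Matrix.mul_add,
      ← Matrix.mul_add, Matrix.diagonal_add, Matrix.diagonal_add]
    have z1 : (fun i => (((-θ i * (θ i * Real.cos (θ i * t)) : ℝ) : 𝕜)) +
        ((Real.cos (θ i * t) * θ i ^ 2 : ℝ) : 𝕜)) = fun _ => 0 := by
      ext i
      rw [← RCLike.ofReal_add, ← RCLike.ofReal_zero]
      congr 1
      ring
    have z2 : (fun i => (((θ i * (-θ i * Real.sin (θ i * t)) : ℝ) : 𝕜)) +
        ((Real.sin (θ i * t) * θ i ^ 2 : ℝ) : 𝕜)) = fun _ => 0 := by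
      ext i
      rw [← RCLike.ofReal_add, ← RCLike.ofReal_zero]
      congr 1
      ring
    rw [z1, z2, Matrix.diagonal_zero]
    simp
  · simpa [hu] using ha
  · have : u 1 = b := by
      have e : c * diagonal (fun i => ((Real.sin (θ i) : ℝ) : 𝕜)) = E := by
        rw [hc, Matrix.mul_assoc, diagonal_ofReal_mul]
        ext k i
        rw [Matrix.mul_diagonal]
        by_cases hi : Real.sin (θ i) = 0
        · rw [hE0 i hi k, zero_mul]
        · rw [inv_mul_cancel₀ hi, RCLike.ofReal_one, mul_one]
      simp only [hu, mul_one, e, hcosθ]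
      rw [hE]
      abel
    rw [this]
    exact hb
  · rw [horizontalLength_eq (c := ∑ i, θ i ^ 2) fun t ht => by
      rw [hQ t ht, Matrix.trace_diagonal]
      simp, dGr]
    simp only [hangle', hθ]

/-! ### Quasi-geodesics -/

/-- The product rule for `uSuᴴ` exhibits `(u', S')` as the horizontal lift of `μ'`, so the metric
can be evaluated at `(u, S)`. -/
theorem gMetric_velocity {U V : Submodule 𝕜 (EuclideanSpace 𝕜 (Fin n))}
    {u : ℝ → Matrix (Fin n) (Fin r) 𝕜} {C D : Matrix (Fin r) (Fin r) 𝕜}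
    {S : ℝ → Matrix (Fin r) (Fin r) 𝕜} {μ : ℝ → Matrix (Fin n) (Fin n) 𝕜}
    (hu : IsLiftOfGeodesic U V u) (hS : IsPDGeodesic C D S)
    (hμ : ∀ t ∈ Icc (0 : ℝ) 1, μ t = u t * S t * (u t)ᴴ) {t : ℝ} (ht : t ∈ Icc (0 : ℝ) 1) (k : ℝ) :
    gMetric r k (μ t) (velocity μ t) (velocity μ t) =
      RCLike.re ((velocity u t)ᴴ * velocity u t).trace + k * dPD C D ^ 2 := by
  have hv := hu.smooth.hasVelocity ht
  have hw := hS.smooth.hasVelocity ht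
  have h : IsHorizontalVector (μ t) (velocity μ t) (u t) (S t) (velocity u t) (velocity S t) := by
    refine ⟨hu.orthonormal t ht, hS.posDef t ht, hμ t ht, hu.horizontal t ht, ?_, ?_⟩
    · have e := (hw.conjTranspose.congr ht fun s hs =>
        (hS.posDef s hs).isHermitian.eq.symm).velocity_eq ht
      exact e.symm
    · rw [(((hv.mul hw).mul hv.conjTranspose).congr ht hμ).velocity_eq ht, Matrix.add_mul]
      abel
  rw [gMetric_eq h h, liftedMetric, hS.trace_eq ht]

end PSDGeom

/-! ### The main theorem -/

theorem mainTheorem4 {𝕜 : Type*} [RCLike 𝕜] {n r : ℕ} (hr : 0 < r)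
    (A B : Matrix (Fin n) (Fin n) 𝕜)
    (hA : A ∈ PSDGeom.HermPlus 𝕜 n r) (hB : B ∈ PSDGeom.HermPlus 𝕜 n r)
    (hangle : ∀ i : Fin r,
      PSDGeom.principalAngle r (PSDGeom.proj A) (PSDGeom.proj B) i < Real.pi / 2) :
    (∃ μ : ℝ → Matrix (Fin n) (Fin n) 𝕜, PSDGeom.IsQuasiGeodesic r A B μ) ∧
    ∀ μ : ℝ → Matrix (Fin n) (Fin n) 𝕜, PSDGeom.IsQuasiGeodesic r A B μ →
      PSDGeom.GD (PSDGeom.dGr r) (PSDGeom.dPD (r := r)) A B = PSDGeom.gLength r 1 μ := by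
  obtain ⟨a, b, hab⟩ := PSDGeom.exists_isPrincipal (PSDGeom.finrank_proj hA)
    (PSDGeom.finrank_proj hB)
  obtain ⟨w, hw, hwl⟩ := hab.exists_isLiftOfGeodesic
  refine ⟨?_, ?_⟩
  · obtain ⟨S, hS⟩ := PSDGeom.exists_isPDGeodesic
      (PSDGeom.conjTranspose_mul_mul_posDef hA.1 hw.source)
      (PSDGeom.conjTranspose_mul_mul_posDef hB.1 hw.target)
    -- The length of `w` equals the lower bound valid for all geodesics, so `w` is minimal.
    exact ⟨_, w, S, ⟨hw, fun w' hw' => hwl.le.trans hw'.dGr_le⟩, hS, fun _ _ => rfl⟩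
  · rintro μ ⟨u, S, ⟨hu, hmin⟩, hS, hμ⟩
    -- Comparison with `w` shows that an arbitrary minimal geodesic has length at most the distance.
    obtain ⟨hpd, htr⟩ := hu.posDef_of_horizontalLength_le ((hmin w hw).trans hwl.le) hangle
    have hH : PSDGeom.hausdorff PSDGeom.dPD (PSDGeom.reprPairs r A B) =
        PSDGeom.dPD ((u 0)ᴴ * A * u 0) ((u 1)ᴴ * B * u 1) := by
      refine PSDGeom.hausdorff_eq_of_forall ⟨_, a, b, hab, rfl⟩ ?_
      rintro _ ⟨a', b', hab', rfl⟩
      refine PSDGeom.dPD_eq_of_isFrame hA.1 hB.1 hu.source hu.target hab'.1 hab'.2.1 hpd ?_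
      -- An angle below `π/2` means a positive cosine, so `a'ᴴb'` is positive definite.
      have hang := PSDGeom.principalAngle_eq hab'
      obtain ⟨-, -, σ, -, -, hσ⟩ := hab'
      rw [hσ]
      refine Matrix.posDef_diagonal_iff.mpr fun i => ?_
      have h1 := hangle i
      rw [hang, hσ, Matrix.diagonal_apply_eq, RCLike.ofReal_re, Real.arccos_lt_pi_div_two] at h1
      exact_mod_cast h1
    rw [PSDGeom.GD, hH, PSDGeom.gLength, intervalIntegral.integral_congr
      (g := fun _ => Real.sqrt (PSDGeom.dGr r (PSDGeom.proj A) (PSDGeom.proj B) ^ 2 +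
        PSDGeom.dPD ((u 0)ᴴ * A * u 0) ((u 1)ᴴ * B * u 1) ^ 2))]
    · simp
    · intro t ht
      rw [uIcc_of_le zero_le_one] at ht
      simp only [PSDGeom.gMetric_velocity hu hS hμ ht, htr t ht, one_mul]
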